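/- Let $\mu$ be the normalised Haar measure on $\mathrm{SU}(2)$, and let ${\bm Z}_1,{\bm Z}_2,{\bm Z}_3$ be the left-invariant vector fields on $\mathrm{SU}(2)$ generated by $-\tfrac{i}{2}\sigma_j$ ($\sigma_j$ the Pauli matrices), so that $[{\bm Z}_i,{\bm Z}_j]=\epsilon_{ijk}{\bm Z}_k$. Put ${\bm X}_\pm = -({\bm Z}_2 \pm i {\bm Z}_1)$ and ${\bm Z}^\alpha = {\bm Z}_1^{\alpha_1}{\bm Z}_2^{\alpha_2}{\bm Z}_3^{\alpha_3}$ for a multi-index $\alpha$. For $\varepsilon\in(0,1)$, $\rho_\star>0$, $\tau_\star\in(-1,1)$ and $t\in(\tau_\star,1]$ let \[ \mathcal{N}_t = \Big\{(\tau,\rho,g)\in[-1,1]\times[0,\infty)\times\mathrm{SU}(2) : \tau_\star\le\tau\le t,\ 0\le\rho\le \tfrac{2\varepsilon}{2-\varepsilon}\,\tfrac{\rho_\star}{1+\tau}\Big\}, \qquad \mathcal{S}_\star = \mathcal{N}_t\cap\{\tau=\tau_\star\}. \] For all $\tau_\star\in(-1,1)$ and all non-negative integers $p,m$ with $p>m+1$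 there is a constant $C_{p,m}>0$, depending only on $p$, $m$ and $\tau_\star$ (in particular independent of $t$), such that the following holds for all $\varepsilon\in(0,1)$, $\rho_\star>0$ and $t\in(\tau_\star,1]$. Let $\psi,\psi_0,\psi_1,\psi_2$ be complex-valued functions that, at all points of $\mathcal{N}_t$ with $\tau<1$ and $\rho>0$, are of class $C^{p+m+1}$ (up to and slightly across the remaining boundary) and satisfy the transport hierarchy \begin{align*} &(1+\tau)\partial_\tau\psi_2-\rho\partial_\rho\psi_2-\tfrac12{\bm X}_-\psi-{\bm X}_-\psi_1=0,\\ &(1-\tau)\partial_\tau\psi_1+\rho\partial_\rho\psi_1+\tfrac12\big((1-\tau)\partial_\tau\psi+\rho\partial_\rho\psi\big)-{\bm X}_+\psi_2-\tfrac12\psi-\psi_1=0,\\ &(1+\tau)\partial_\tau\psi_1-\rho\partial_\rho\psi_1-\tfrac12\big((1+\tau)\partial_\tau\psi-\rho\partial_\rho\psi\big)-{\bm X}_-\psi_0-\tfrac12\psi+\psi_1=0,\\ &(1-\tau)\partial_\tau\psi_0+\rho\partial_\rho\psi_0+\tfrac12{\bm X}_+\psi-{\bm X}_+\psi_1=0.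 \end{align*} If \[ \mathcal{E}_\star := \int_{\mathcal{S}_\star}\sum_{p'+q'+|\alpha|\le m}\Big(\sum_{k=0}^2|\partial_\rho^{p'}\partial_\tau^{q'}{\bm Z}^\alpha\partial_\rho^p\psi_k|^2+|\partial_\rho^{p'}\partial_\tau^{q'}{\bm Z}^\alpha\partial_\rho^p\psi|^2\Big)\,\mathrm{d}\rho\,\mathrm{d}\mu<\infty, \] then \[ \sum_{k=0}^2\|\partial_\rho^p\psi_k\|^2_{H^m(\mathcal{N}_t)}+\|\partial_\rho^p\psi\|^2_{H^m(\mathcal{N}_t)}\le C_{p,m}\,\mathcal{E}_\star, \] where \[ \|f\|^2_{H^m(\mathcal{N}_t)}=\int_{\mathcal{N}_t}\sum_{p'+q'+|\alpha|\le m}|\partial_\rho^{p'}\partial_\tau^{q'}{\bm Z}^\alpha f|^2\,\mathrm{d}\tau\,\mathrm{d}\rho\,\mathrm{d}\mu. \] -/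

import Mathlib

open MeasureTheory Set Topology
open scoped ENNReal

noncomputable section

namespace FGauge

/-- The group `SU(2)` of unitary `2 × 2` complex matrices of determinant one. -/
abbrev SU2 : Type := Matrix.specialUnitaryGroup (Fin 2) ℂ

instance instIsTopologicalGroupSU2 : IsTopologicalGroup SU2 where
  continuous_mul := by
    refine Continuous.subtype_mk ?_ _
    exact (continuous_subtype_val.comp continuous_fst).mul
      (continuous_subtype_val.comp continuous_snd)
  continuous_inv := by
    refine Continuous.subtype_mk ?_ _
    exact Continuous.star continuous_subtype_val

instance instCompactSpaceSU2 : CompactSpace SU2 := by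
  have hK : IsCompact {A : Matrix (Fin 2) (Fin 2) ℂ | ∀ i j, ‖A i j‖ ≤ 1} := by
    have h : {A : Matrix (Fin 2) (Fin 2) ℂ | ∀ i j, ‖A i j‖ ≤ 1} =
        Set.pi univ fun _ : Fin 2 => Set.pi univ fun _ : Fin 2 => Metric.closedBall (0 : ℂ) 1 := by
      ext A
      exact ⟨fun h i _ j _ => by simpa using h i j,
        fun h i j => by simpa using h i trivial j trivial⟩
    rw [h]
    exact isCompact_univ_pi fun _ => isCompact_univ_pi fun _ => isCompact_closedBall 0 1
  have hc : IsClosed {A : Matrix (Fin 2) (Fin 2) ℂ | star A * A = 1 ∧ A.det = 1} := by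
    refine IsClosed.and ?_ ?_
    · exact isClosed_eq ((Continuous.star continuous_id).mul continuous_id) continuous_const
    · exact isClosed_eq (Continuous.matrix_det continuous_id) continuous_const
  have hs : ((Matrix.specialUnitaryGroup (Fin 2) ℂ : Submonoid _) :
      Set (Matrix (Fin 2) (Fin 2) ℂ)) =
      {A | ∀ i j, ‖A i j‖ ≤ 1} ∩ {A | star A * A = 1 ∧ A.det = 1} := by
    ext A
    simp only [SetLike.mem_coe, Matrix.mem_specialUnitaryGroup_iff, mem_inter_iff, mem_ofPred_eq,
      Matrix.mem_unitaryGroup_iff']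
    refine ⟨fun h => ⟨fun i j => ?_, h⟩, fun h => h.2⟩
    exact entry_norm_bound_of_unitary (Matrix.mem_unitaryGroup_iff'.2 h.1) i j
  exact isCompact_iff_compactSpace.1 (hs ▸ hK.inter_right hc)

instance instMeasurableSpaceSU2 : MeasurableSpace SU2 := borel SU2

instance instBorelSpaceSU2 : BorelSpace SU2 := ⟨rfl⟩

/-- The normalised Haar measure on `SU(2)`. -/
def haarSU2 : Measure SU2 := Measure.haarMeasure ⊤

/-- The Haar measure `haarSU2` has total mass one. -/
theorem haarSU2_univ : haarSU2 univ = 1 := by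
  have h := Measure.haarMeasure_self (G := SU2) (K₀ := ⊤)
  rwa [TopologicalSpace.PositiveCompacts.coe_top] at h

/-- Points `(τ, ρ, g)` of `ℝ × ℝ × SU(2)`. -/
abbrev Pt : Type := ℝ × ℝ × SU2

/-- Complex scalar fields (only their values near the region of interest matter). -/
abbrev Field : Type := Pt → ℂ

/-- The Pauli matrices `σ₁, σ₂, σ₃`, indexed by `0, 1, 2`. -/
def pauli : Fin 3 → Matrix (Fin 2) (Fin 2) ℂ :=
  ![!![0, 1; 1, 0], !![0, -Complex.I; Complex.I, 0], !![1, 0; 0, -1]]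

/-- The matrix `cos (s/2) - i sin (s/2) σⱼ`, which equals `exp (s uⱼ)` with `uⱼ = -(i/2) σⱼ`. -/
def oneParamMatrix (j : Fin 3) (s : ℝ) : Matrix (Fin 2) (Fin 2) ℂ :=
  (Complex.cos (s / 2)) • (1 : Matrix (Fin 2) (Fin 2) ℂ) -
    (Complex.I * Complex.sin (s / 2)) • pauli j

theorem oneParamMatrix_mem (j : Fin 3) (s : ℝ) :
    oneParamMatrix j s ∈ Matrix.specialUnitaryGroup (Fin 2) ℂ := by
  have h := Complex.sin_sq_add_cos_sq ((s : ℂ) / 2)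
  have hc : (starRingEnd ℂ) (Complex.cos ((s : ℂ) / 2)) = Complex.cos ((s : ℂ) / 2) := by
    rw [← Complex.cos_conj, map_div₀, Complex.conj_ofReal, Complex.conj_ofNat]
  have hs : (starRingEnd ℂ) (Complex.sin ((s : ℂ) / 2)) = Complex.sin ((s : ℂ) / 2) := by
    rw [← Complex.sin_conj, map_div₀, Complex.conj_ofReal, Complex.conj_ofNat]
  have hI := Complex.I_sq
  rw [Matrix.mem_specialUnitaryGroup_iff, Matrix.mem_unitaryGroup_iff]
  constructor
  · ext a b
    fin_cases j <;> fin_cases a <;> fin_cases b <;>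
      simp [oneParamMatrix, pauli, Matrix.mul_apply, Fin.sum_univ_two, Matrix.star_apply, hc, hs] <;>
      grind
  · fin_cases j <;> simp [oneParamMatrix, pauli, Matrix.det_fin_two] <;> grind

/-- The one-parameter subgroup `s ↦ exp (s uⱼ)` of `SU(2)`, where `uⱼ = -(i/2) σⱼ`, so that
`[u₁, u₂] = u₃` and cyclically. -/
def oneParam (j : Fin 3) (s : ℝ) : SU2 := ⟨oneParamMatrix j s, oneParamMatrix_mem j s⟩

/-- `∂_τ` -/
def dτ (f : Field) : Field := fun x => deriv (fun s : ℝ => f (s, x.2.1, x.2.2)) x.1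

/-- `∂_ρ` -/
def dρ (f : Field) : Field := fun x => deriv (fun s : ℝ => f (x.1, s, x.2.2)) x.2.1

/-- The left-invariant vector fields `Z₁, Z₂, Z₃` on `SU(2)` (indexed by `0, 1, 2`),
`(Zⱼ f)(g) = d/ds f (g exp (s uⱼ))` at `s = 0`; they satisfy `[Zᵢ, Zⱼ] = εᵢⱼₖ Zₖ`. -/
def Z (j : Fin 3) (f : Field) : Field :=
  fun x => deriv (fun s : ℝ => f (x.1, x.2.1, x.2.2 * oneParam j s)) 0

/-- `X₊ = -(Z₂ + i Z₁)` -/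
def Xplus (f : Field) : Field := fun x => -(Z 1 f x + Complex.I * Z 0 f x)

/-- `X₋ = -(Z₂ - i Z₁)` -/
def Xminus (f : Field) : Field := fun x => -(Z 1 f x - Complex.I * Z 0 f x)

/-- `∂_ρ^{p'} ∂_τ^{q'} Z₁^{α₁} Z₂^{α₂} Z₃^{α₃}`, where `n = (p', q', α₁, α₂, α₃)`. -/
def D (n : ℕ × ℕ × ℕ × ℕ × ℕ) (f : Field) : Field :=
  dρ^[n.1] (dτ^[n.2.1] ((Z 0)^[n.2.2.1] ((Z 1)^[n.2.2.2.1] ((Z 2)^[n.2.2.2.2] f))))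

/-- The indices `(p', q', α₁, α₂, α₃)` with `p' + q' + |α| ≤ m`. -/
def indices (m : ℕ) : Finset (ℕ × ℕ × ℕ × ℕ × ℕ) :=
  (Finset.range (m + 1) ×ˢ Finset.range (m + 1) ×ˢ Finset.range (m + 1) ×ˢ
    Finset.range (m + 1) ×ˢ Finset.range (m + 1)).filter
      fun n => n.1 + n.2.1 + (n.2.2.1 + n.2.2.2.1 + n.2.2.2.2) ≤ m

theorem mem_indices {m : ℕ} {n : ℕ × ℕ × ℕ × ℕ × ℕ} :
    n ∈ indices m ↔ n.1 + n.2.1 + (n.2.2.1 + n.2.2.2.1 + n.2.2.2.2) ≤ m := by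
  simp only [indices, Finset.mem_filter, Finset.mem_product, Finset.mem_range]
  omega

/-- The density `∑_{p' + q' + |α| ≤ m} |∂_ρ^{p'} ∂_τ^{q'} Z^α f|²`. -/
def density (m : ℕ) (f : Field) (x : Pt) : ℝ≥0∞ := ∑ n ∈ indices m, ‖D n f x‖ₑ ^ 2

/-- The outer boundary value of `ρ` on the slice of constant `τ`. -/
def ρmax (ε ρs τ : ℝ) : ℝ := (2 * ε / (2 - ε)) * (ρs / (1 + τ))

/-- The domain `N_t`, with initial time `τs`. -/
def domain (ε ρs τs t : ℝ) : Set Pt :=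
  {x | τs ≤ x.1 ∧ x.1 ≤ t ∧ 0 ≤ x.2.1 ∧ x.2.1 ≤ ρmax ε ρs x.1}

/-- The measure `dτ dρ dμ`. -/
def dv : Measure Pt := (volume : Measure ℝ).prod ((volume : Measure ℝ).prod haarSU2)

/-- The squared Sobolev norm `‖f‖²_{H^m(N)}` (possibly infinite) on `N ⊆ ℝ × ℝ × SU(2)`. -/
def sobolevSq (m : ℕ) (N : Set Pt) (f : Field) : ℝ≥0∞ := ∫⁻ x in N, density m f x ∂dv

/-- `∫_{S_τ} ∑_{p' + q' + |α| ≤ m} |∂_ρ^{p'} ∂_τ^{q'} Z^α f|² dρ dμ` over the slice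
`S_τ = {τ} × [0, ρmax] × SU(2)`. -/
def sliceSq (ε ρs : ℝ) (m : ℕ) (τ : ℝ) (f : Field) : ℝ≥0∞ :=
  ∫⁻ y in Icc 0 (ρmax ε ρs τ) ×ˢ (univ : Set SU2), density m f (τ, y)
    ∂((volume : Measure ℝ).prod haarSU2)

/-- `f` is of class `C^k` near the point `x` of the submanifold `ℝ × ℝ × SU(2)` of the vector space
`ℝ × ℝ × M₂(ℂ)`: near `x` it is the restriction of a function that is `C^k` at `x`. -/
def CkAt (k : ℕ) (f : Field) (x : Pt) : Prop :=
  ∃ F : ℝ × ℝ × (Fin 2 → Fin 2 → ℂ) → ℂ,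
    ContDiffAt ℝ k F (x.1, x.2.1, fun a b => x.2.2.1 a b) ∧
      ∀ᶠ y in 𝓝 x, f y = F (y.1, y.2.1, fun a b => y.2.2.1 a b)

/-- The transport hierarchy `A₀ = B₀ = A₁ = B₁ = 0` for `ψ` and `(ψ₀, ψ₁, ψ₂) = (ψk 0, ψk 1, ψk 2)` at the point
`x = (τ, ρ, g)`. -/
structure TransportAt (ψ : Field) (ψk : Fin 3 → Field) (x : Pt) : Prop where
  A0 : (1 + x.1) * dτ (ψk 2) x - x.2.1 * dρ (ψk 2) x - 1 / 2 * Xminus ψ x - Xminus (ψk 1) x = 0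
  B0 : (1 - x.1) * dτ (ψk 1) x + x.2.1 * dρ (ψk 1) x
    + 1 / 2 * ((1 - x.1) * dτ ψ x + x.2.1 * dρ ψ x) - Xplus (ψk 2) x - 1 / 2 * ψ x - ψk 1 x = 0
  A1 : (1 + x.1) * dτ (ψk 1) x - x.2.1 * dρ (ψk 1) x
    - 1 / 2 * ((1 + x.1) * dτ ψ x - x.2.1 * dρ ψ x) - Xminus (ψk 0) x - 1 / 2 * ψ x + ψk 1 x = 0
  B1 : (1 - x.1) * dτ (ψk 0) x + x.2.1 * dρ (ψk 0) x + 1 / 2 * Xplus ψ x - Xplus (ψk 1) x = 0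

end FGauge

end

/-!
With `u = ψ₂`, `v = ψ₁ + ψ / 2` and with `u = ψ₁ - ψ / 2`, `v = ψ₀`, the hierarchy splits into two
pairs of the form `transport 1 u = c₁ u + X₋ v`, `transport (-1) v = c₂ v + X₊ u` with `c₁ ≤ 0` and
`c₂ ≤ 1`. Every `∂_ρ` commuted through a transport operator shifts its zeroth-order coefficient by
one, with opposite signs in the two equations, and every `∂_τ` shifts it back. Since `p > m + 1`,
the `p` derivatives `∂_ρ` win over the at most `m` derivatives `∂_τ`: the energy of `v` comes out
with a negative sign, which absorbs the commutator terms, while the energy of `u` is handled by the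
weight `exp (-l τ)`. As the vector field `(1 - τ) ∂_τ + ρ ∂_ρ` becomes tangent to `τ = 1`, no such
weight could replace the sign for `v`.

The resulting inequality is integrated against cut-offs in `ρ (1 + τ)` and `ρ (1 - τ)`, whose
derivatives along both transport fields have the favourable sign. The divergence theorem in `(τ, ρ)`
and the invariance of the Haar measure under right translations then leave only the initial slice,
and the bound passes to the limit as the cut-offs exhaust the domain. The parallelogram law turns
the estimates for `ψ₁ ± ψ / 2` into one for `ψ₁` and `ψ`.
-/

noncomputable section

namespace FGauge

/-- The vector space in which `ℝ × ℝ × SU(2)` is embedded. -/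
abbrev Ambient : Type := ℝ × ℝ × (Fin 2 → Fin 2 → ℂ)

/-- The embedding of `ℝ × ℝ × SU(2)` in its ambient vector space. -/
def toAmbient (x : Pt) : Ambient := (x.1, x.2.1, fun a b => x.2.2.1 a b)

/-- The directions of the frame `∂_τ, ∂_ρ, Z₁, Z₂, Z₃` on `ℝ × ℝ × SU(2)`. -/
inductive Direction : Type
  | τ : Direction
  | ρ : Direction
  | z : Fin 3 → Direction
  deriving DecidableEq, Fintype

/-- The derivative in a given direction of the frame. -/
def dirDeriv : Direction → Field → Field
  | .τ => dτ
  | .ρ => dρ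
  | .z j => Z j

/-- The flow of the frame field belonging to a direction. -/
def flow : Direction → Pt → ℝ → Pt
  | .τ, x, s => (x.1 + s, x.2)
  | .ρ, x, s => (x.1, x.2.1 + s, x.2.2)
  | .z j, x, s => (x.1, x.2.1, x.2.2 * oneParam j s)

/-- The element `-(i/2) σⱼ` of the Lie algebra of `SU(2)`. -/
def generator (j : Fin 3) : Matrix (Fin 2) (Fin 2) ℂ := -(Complex.I / 2) • pauli j

/-- The linear vector field `(τ, ρ, A) ↦ (0, 0, A B)` on the ambient space. -/
def rightMul (B : Matrix (Fin 2) (Fin 2) ℂ) : Ambient →L[ℝ] Ambient :=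
  LinearMap.toContinuousLinearMap
    { toFun := fun y => (0, 0, fun a b => ∑ c, y.2.2 a c * B c b)
      map_add' := fun y y' => by
        ext
        · simp
        · simp
        · simp only [Prod.snd_add, Pi.add_apply, add_mul, Fin.sum_univ_two, Prod.mk_add_mk]
          ring
      map_smul' := fun r y => by
        ext
        · simp
        · simp
        · simp only [Prod.smul_snd, Pi.smul_apply, Complex.real_smul, Fin.sum_univ_two,
            Real.ringHom_apply, Prod.smul_mk]
          ring }

/-- The extension of a frame field to a vector field on the ambient space. -/
def ambientField : Direction → Ambient → Ambient
  | .τ, _ => (1, 0, 0)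
  | .ρ, _ => (0, 1, 0)
  | .z j, y => rightMul (generator j) y

theorem continuous_toAmbient : Continuous toAmbient := by
  have h : Continuous fun x : Pt => x.2.2.1 := continuous_snd.snd.subtype_val
  exact continuous_fst.prodMk (continuous_snd.fst.prodMk h)

theorem contDiff_ambientField (i : Direction) {n : WithTop ℕ∞} :
    ContDiff ℝ n (ambientField i) := by
  cases i with
  | τ => exact contDiff_const
  | ρ => exact contDiff_const
  | z j => exact (rightMul (generator j)).contDiff

theorem oneParam_zero (j : Fin 3) : oneParam j 0 = 1 :=
  Subtype.ext (by simp [oneParam, oneParamMatrix])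

theorem flow_zero (i : Direction) (x : Pt) : flow i x 0 = x := by
  cases i <;> simp [flow, oneParam_zero]

theorem continuous_oneParam (j : Fin 3) : Continuous (oneParam j) := by
  refine Continuous.subtype_mk ?_ _
  unfold oneParamMatrix
  fun_prop

theorem continuous_flow (i : Direction) (x : Pt) : Continuous (flow i x) := by
  have := continuous_oneParam
  change Continuous fun s => flow i x s
  cases i <;> simp only [flow] <;> fun_prop

theorem tendsto_flow_zero (i : Direction) (x : Pt) : Filter.Tendsto (flow i x) (𝓝 0) (𝓝 x) := by
  simpa only [flow_zero] using (continuous_flow i x).tendsto 0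

theorem dirDeriv_eq_deriv (i : Direction) (f : Field) (x : Pt) :
    dirDeriv i f x = deriv (fun s => f (flow i x s)) 0 := by
  cases i with
  | τ =>
    have h := deriv_comp_const_add (fun s => f (s, x.2.1, x.2.2)) x.1 0
    rw [add_zero] at h
    exact h.symm
  | ρ =>
    have h := deriv_comp_const_add (fun s => f (x.1, s, x.2.2)) x.2.1 0
    rw [add_zero] at h
    exact h.symm
  | z j => rfl

theorem hasDerivAt_oneParam (j : Fin 3) (a b : Fin 2) :
    HasDerivAt (fun s : ℝ => (oneParam j s).1 a b) (generator j a b) 0 := by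
  have half : HasDerivAt (fun s : ℝ => (s : ℂ) / 2) (1 / 2) 0 :=
    (Complex.ofRealCLM.hasDerivAt (x := (0 : ℝ))).div_const 2
  have hcos := (Complex.hasDerivAt_cos (((0 : ℝ) : ℂ) / 2)).comp (0 : ℝ) half
  have hsin := (Complex.hasDerivAt_sin (((0 : ℝ) : ℂ) / 2)).comp (0 : ℝ) half
  have := (hcos.mul_const ((1 : Matrix (Fin 2) (Fin 2) ℂ) a b)).sub
    ((hsin.const_mul Complex.I).mul_const (pauli j a b))
  refine HasDerivAt.congr_deriv this ?_
  simp only [generator, Matrix.smul_apply, smul_eq_mul, Complex.ofReal_zero, zero_div,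
    Complex.sin_zero, Complex.cos_zero]
  ring

theorem hasDerivAt_toAmbient_flow (i : Direction) (x : Pt) :
    HasDerivAt (fun s => toAmbient (flow i x s)) (ambientField i (toAmbient x)) 0 := by
  have hconst {V : Type} [NormedAddCommGroup V] [NormedSpace ℝ V] (v : V) :
      HasDerivAt (fun _ : ℝ => v) 0 0 := hasDerivAt_const 0 v
  have hadd (a : ℝ) : HasDerivAt (fun s : ℝ => a + s) 1 0 := (hasDerivAt_id 0).const_add a
  cases i with
  | τ => exact (hadd x.1).prodMk ((hconst (toAmbient x).2.1).prodMk (hconst (toAmbient x).2.2))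
  | ρ => exact (hconst (toAmbient x).1).prodMk ((hadd x.2.1).prodMk (hconst (toAmbient x).2.2))
  | z j =>
    refine (hconst (toAmbient x).1).prodMk ((hconst (toAmbient x).2.1).prodMk ?_)
    refine hasDerivAt_pi.2 fun a => hasDerivAt_pi.2 fun b => ?_
    simp only [flow, Submonoid.coe_mul, Matrix.mul_apply]
    exact HasDerivAt.fun_sum fun c _ => (hasDerivAt_oneParam j c b).const_mul _

theorem hasDerivAt_comp_flow {F : Ambient → ℂ} {f : Field} {x : Pt}
    (hF : DifferentiableAt ℝ F (toAmbient x)) (hf : ∀ᶠ y in 𝓝 x, f y = F (toAmbient y))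
    (i : Direction) :
    HasDerivAt (fun s => f (flow i x s))
      (fderiv ℝ F (toAmbient x) (ambientField i (toAmbient x))) 0 :=
  (hF.hasFDerivAt.comp_hasDerivAt_of_eq (0 : ℝ) (hasDerivAt_toAmbient_flow i x)
    (by rw [flow_zero])).congr_of_eventuallyEq ((tendsto_flow_zero i x).eventually hf)

theorem dirDeriv_eventuallyEq_fderiv {F : Ambient → ℂ} {f : Field} {x : Pt}
    (hF : ContDiffAt ℝ 1 F (toAmbient x)) (hf : ∀ᶠ y in 𝓝 x, f y = F (toAmbient y))
    (i : Direction) :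
    ∀ᶠ y in 𝓝 x, dirDeriv i f y = fderiv ℝ F (toAmbient y) (ambientField i (toAmbient y)) := by
  have hF' : ∀ᶠ y in 𝓝 x, ContDiffAt ℝ 1 F (toAmbient y) :=
    continuous_toAmbient.continuousAt.eventually (hF.eventually (by simp))
  filter_upwards [hF', eventually_eventually_nhds.2 hf] with y hFy hfy
  rw [dirDeriv_eq_deriv, (hasDerivAt_comp_flow (hFy.differentiableAt (by simp)) hfy i).deriv]

namespace CkAt

variable {k l : ℕ} {f g : Field} {x : Pt}

theorem of_contDiff {F : ℝ × ℝ → ℂ} (hF : ContDiff ℝ k F) :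
    CkAt k (fun y => F (y.1, y.2.1)) x :=
  ⟨fun y => F (y.1, y.2.1), by fun_prop, .of_forall fun _ => rfl⟩

theorem const (c : ℂ) : CkAt k (fun _ => c) x := of_contDiff contDiff_const

theorem congr (hf : CkAt k f x) (h : g =ᶠ[𝓝 x] f) : CkAt k g x := by
  obtain ⟨F, hF, hfF⟩ := hf
  exact ⟨F, hF, h.trans hfF⟩

theorem mono (hf : CkAt k f x) (h : l ≤ k) : CkAt l f x := by
  obtain ⟨F, hF, hfF⟩ := hf
  exact ⟨F, hF.of_le (by exact_mod_cast h), hfF⟩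

theorem add (hf : CkAt k f x) (hg : CkAt k g x) : CkAt k (fun y => f y + g y) x := by
  obtain ⟨F, hF, hfF⟩ := hf
  obtain ⟨G, hG, hgG⟩ := hg
  exact ⟨_, hF.add hG, by filter_upwards [hfF, hgG] with y hfy hgy; rw [hfy, hgy]⟩

theorem mul (hf : CkAt k f x) (hg : CkAt k g x) : CkAt k (fun y => f y * g y) x := by
  obtain ⟨F, hF, hfF⟩ := hf
  obtain ⟨G, hG, hgG⟩ := hg
  exact ⟨_, hF.mul hG, by filter_upwards [hfF, hgG] with y hfy hgy; rw [hfy, hgy]⟩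

theorem const_mul (c : ℂ) (hf : CkAt k f x) : CkAt k (fun y => c * f y) x := (const c).mul hf

theorem conj (hf : CkAt k f x) : CkAt k (fun y => (starRingEnd ℂ) (f y)) x := by
  obtain ⟨F, hF, hfF⟩ := hf
  refine ⟨fun y => Complex.conjCLE (F y), Complex.conjCLE.contDiff.contDiffAt.comp _ hF, ?_⟩
  exact hfF.mono fun y hy => congrArg _ hy

theorem sum {ι : Type*} {s : Finset ι} {f : ι → Field} (hf : ∀ i ∈ s, CkAt k (f i) x) :
    CkAt k (fun y => ∑ i ∈ s, f i y) x := by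
  classical
  induction s using Finset.induction_on with
  | empty => simpa using const 0
  | insert a s ha ih =>
    simp only [Finset.sum_insert ha]
    exact (hf _ (Finset.mem_insert_self _ _)).add (ih fun i hi => hf i (by simp [hi]))

theorem continuousAt (hf : CkAt k f x) : ContinuousAt f x := by
  obtain ⟨F, hF, hfF⟩ := hf
  have h : ContinuousAt (F ∘ toAmbient) x :=
    ContinuousAt.comp (f := toAmbient) hF.continuousAt continuous_toAmbient.continuousAt
  exact h.congr (Filter.EventuallyEq.symm hfF)

theorem eventually (hf : CkAt k f x) : ∀ᶠ y in 𝓝 x, CkAt k f y := by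
  obtain ⟨F, hF, hfF⟩ := hf
  have hF' : ∀ᶠ y in 𝓝 x, ContDiffAt ℝ k F (toAmbient y) :=
    continuous_toAmbient.continuousAt.eventually (hF.eventually (by simp))
  filter_upwards [hF', eventually_eventually_nhds.2 hfF] with y hFy hfy
  exact ⟨F, hFy, hfy⟩

theorem hasDerivAt (hf : CkAt 1 f x) (i : Direction) :
    HasDerivAt (fun s => f (flow i x s)) (dirDeriv i f x) 0 := by
  obtain ⟨F, hF, hfF⟩ := hf
  have h := hasDerivAt_comp_flow (hF.differentiableAt (by simp)) hfF i
  rw [dirDeriv_eq_deriv]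
  exact h.differentiableAt.hasDerivAt

theorem dirDeriv (hf : CkAt (k + 1) f x) (i : Direction) : CkAt k (dirDeriv i f) x := by
  obtain ⟨F, hF, hfF⟩ := hf
  refine ⟨fun y => fderiv ℝ F y (ambientField i y), ?_,
    dirDeriv_eventuallyEq_fderiv (hF.of_le (by simp)) hfF i⟩
  exact (hF.fderiv_right (by norm_cast)).clm_apply (contDiff_ambientField i).contDiffAt

end CkAt

section Rules

variable {f g : Field} {x : Pt} (i : Direction)

theorem dirDeriv_congr (h : f =ᶠ[𝓝 x] g) : dirDeriv i f =ᶠ[𝓝 x] dirDeriv i g := by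
  filter_upwards [eventually_eventually_nhds.2 h] with y hy
  rw [dirDeriv_eq_deriv, dirDeriv_eq_deriv]
  exact Filter.EventuallyEq.deriv_eq ((tendsto_flow_zero i y).eventually hy)

theorem dirDeriv_const (c : ℂ) : dirDeriv i (fun _ => c) x = 0 := by
  rw [dirDeriv_eq_deriv, deriv_const]

theorem dirDeriv_add (hf : CkAt 1 f x) (hg : CkAt 1 g x) :
    dirDeriv i (fun y => f y + g y) x = dirDeriv i f x + dirDeriv i g x := by
  rw [dirDeriv_eq_deriv]; exact ((hf.hasDerivAt i).add (hg.hasDerivAt i)).deriv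

theorem dirDeriv_mul (hf : CkAt 1 f x) (hg : CkAt 1 g x) :
    dirDeriv i (fun y => f y * g y) x = dirDeriv i f x * g x + f x * dirDeriv i g x := by
  rw [dirDeriv_eq_deriv, ((hf.hasDerivAt i).fun_mul (hg.hasDerivAt i)).deriv, flow_zero]

theorem dirDeriv_const_mul (c : ℂ) (hf : CkAt 1 f x) :
    dirDeriv i (fun y => c * f y) x = c * dirDeriv i f x := by
  rw [dirDeriv_mul i (CkAt.const c) hf, dirDeriv_const, zero_mul, zero_add]

theorem dirDeriv_conj (hf : CkAt 1 f x) :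
    dirDeriv i (fun y => (starRingEnd ℂ) (f y)) x = (starRingEnd ℂ) (dirDeriv i f x) := by
  rw [dirDeriv_eq_deriv]; exact (hf.hasDerivAt i).star.deriv

theorem dirDeriv_sum {ι : Type*} {s : Finset ι} {f : ι → Field} (hf : ∀ j ∈ s, CkAt 1 (f j) x) :
    dirDeriv i (fun y => ∑ j ∈ s, f j y) x = ∑ j ∈ s, dirDeriv i (f j) x := by
  rw [dirDeriv_eq_deriv]; exact (HasDerivAt.fun_sum fun j hj => (hf j hj).hasDerivAt i).deriv

theorem exists_dirDeriv_commutator_eq_lieBracket (hf : CkAt 2 f x) : ∃ φ : Ambient →L[ℝ] ℂ,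
    (∀ i, dirDeriv i f x = φ (ambientField i (toAmbient x))) ∧
      ∀ i j, dirDeriv i (dirDeriv j f) x - dirDeriv j (dirDeriv i f) x =
        φ (VectorField.lieBracket ℝ (ambientField i) (ambientField j) (toAmbient x)) := by
  obtain ⟨F, hF, hfF⟩ := hf
  have hfirst := dirDeriv_eventuallyEq_fderiv (hF.of_le (by norm_cast)) hfF
  have hfield (i : Direction) : DifferentiableAt ℝ (ambientField i) (toAmbient x) :=
    (contDiff_ambientField i (n := 1)).differentiable (by simp) _
  have hsecond (i j : Direction) : dirDeriv i (dirDeriv j f) x =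
      fderiv ℝ (fun y => fderiv ℝ F y (ambientField j y)) (toAmbient x)
        (ambientField i (toAmbient x)) := by
    have hd : DifferentiableAt ℝ (fun y => fderiv ℝ F y (ambientField j y)) (toAmbient x) :=
      ((hF.fderiv_right (m := 1) (by norm_cast)).differentiableAt (by simp)).clm_apply (hfield j)
    rw [dirDeriv_eq_deriv, (hasDerivAt_comp_flow hd (hfirst j) i).deriv]
  refine ⟨fderiv ℝ F (toAmbient x), fun i => (hfirst i).self_of_nhds, fun i j => ?_⟩
  rw [hsecond, hsecond]
  exact (VectorField.fderiv_apply_lieBracket hF (by simp) (hfield j) (hfield i)).symm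

end Rules

theorem lieBracket_ambientField_of_ne_z {i : Direction} (hi : ∀ k, i ≠ .z k) (j : Direction)
    (y : Ambient) : VectorField.lieBracket ℝ (ambientField i) (ambientField j) y = 0 := by
  have hz (j : Fin 3) : fderiv ℝ (ambientField (.z j)) y = rightMul (generator j) :=
    (rightMul (generator j)).fderiv
  have hτ : fderiv ℝ (ambientField .τ) y = 0 := fderiv_const_apply _
  have hρ : fderiv ℝ (ambientField .ρ) y = 0 := fderiv_const_apply _
  have hmul (B : Matrix (Fin 2) (Fin 2) ℂ) (τ ρ : ℝ) : rightMul B (τ, ρ, 0) = 0 := by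
    ext <;> simp [rightMul]
  rcases i with _ | _ | k
  · cases j with
    | z j => rw [VectorField.lieBracket, hz, hτ, zero_apply, sub_zero]; exact hmul _ _ _
    | _ => simp [VectorField.lieBracket, hτ, hρ]
  · cases j with
    | z j => rw [VectorField.lieBracket, hz, hρ, zero_apply, sub_zero]; exact hmul _ _ _
    | _ => simp [VectorField.lieBracket, hτ, hρ]
  · exact absurd rfl (hi k)

theorem lieBracket_ambientField_z (i j : Fin 3) (y : Ambient) :
    VectorField.lieBracket ℝ (ambientField (.z i)) (ambientField (.z j)) y =
      rightMul (generator i * generator j - generator j * generator i) y := by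
  have hz (j : Fin 3) : fderiv ℝ (ambientField (.z j)) y = rightMul (generator j) :=
    (rightMul (generator j)).fderiv
  simp only [VectorField.lieBracket, hz]
  ext a b
  · simp [ambientField, rightMul]
  · simp [ambientField, rightMul]
  · simp only [rightMul, Fin.sum_univ_two, ambientField, LinearMap.coe_toContinuousLinearMap',
      LinearMap.coe_mk, AddHom.coe_mk, Prod.mk_sub_mk, Pi.sub_apply, Matrix.sub_apply,
      Matrix.mul_apply]
    ring

theorem exists_generator_commutator_eq_smul (i j : Fin 3) : ∃ (c : ℝ) (k : Fin 3),
    generator i * generator j - generator j * generator i = c • generator k := by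
  have hI := Complex.I_mul_I
  have cyclic (i : Fin 3) : generator i * generator (i + 1) - generator (i + 1) * generator i =
      generator (i + 2) := by
    ext a b
    fin_cases i <;> fin_cases a <;> fin_cases b <;>
      simp [generator, pauli] <;> grind
  obtain rfl | rfl | rfl : j = i ∨ j = i + 1 ∨ i = j + 1 := by revert i j; decide
  · exact ⟨0, j, by simp⟩
  · exact ⟨1, i + 2, by rw [cyclic, one_smul]⟩
  · exact ⟨-1, j + 2, by rw [← neg_sub, cyclic, neg_one_smul]⟩

theorem dirDeriv_comm_of_ne_z {i : Direction} (hi : ∀ k, i ≠ .z k) (j : Direction) {f : Field}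
    {x : Pt} (hf : CkAt 2 f x) : dirDeriv i (dirDeriv j f) x = dirDeriv j (dirDeriv i f) x := by
  obtain ⟨φ, -, hφ⟩ := exists_dirDeriv_commutator_eq_lieBracket hf
  rw [← sub_eq_zero, hφ, lieBracket_ambientField_of_ne_z hi, map_zero]

theorem exists_dirDeriv_z_commutator (i j : Fin 3) : ∃ (c : ℂ) (k : Fin 3), ∀ {f : Field} {x : Pt},
    CkAt 2 f x → dirDeriv (.z i) (dirDeriv (.z j) f) x =
      dirDeriv (.z j) (dirDeriv (.z i) f) x + c * dirDeriv (.z k) f x := by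
  obtain ⟨c, k, hc⟩ := exists_generator_commutator_eq_smul i j
  refine ⟨c, k, fun {f x} hf => ?_⟩
  obtain ⟨φ, hfirst, hφ⟩ := exists_dirDeriv_commutator_eq_lieBracket hf
  have hsmul : rightMul (c • generator k) (toAmbient x) =
      c • rightMul (generator k) (toAmbient x) := by
    ext a b
    · simp [rightMul]
    · simp [rightMul]
    · simp only [rightMul, Matrix.smul_apply, Complex.real_smul, Fin.sum_univ_two,
        LinearMap.coe_toContinuousLinearMap', LinearMap.coe_mk, AddHom.coe_mk, Prod.smul_mk,
        Pi.smul_apply]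
      ring
  rw [← sub_eq_iff_eq_add', hφ, lieBracket_ambientField_z, hc, hsmul, map_smul,
    Complex.real_smul, hfirst, ambientField]

/-- The iterated derivative along a word of directions, the last letter acting first. -/
def wordDeriv (l : List Direction) (f : Field) : Field := l.foldr dirDeriv f

theorem wordDeriv_cons (i : Direction) (l : List Direction) (f : Field) :
    wordDeriv (i :: l) f = dirDeriv i (wordDeriv l f) := rfl

theorem wordDeriv_append (l l' : List Direction) (f : Field) :
    wordDeriv (l ++ l') f = wordDeriv l (wordDeriv l' f) := List.foldr_append

theorem wordDeriv_replicate (i : Direction) (k : ℕ) (f : Field) :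
    wordDeriv (List.replicate k i) f = (dirDeriv i)^[k] f := by
  induction k with
  | zero => rfl
  | succ k ih => rw [List.replicate_succ, wordDeriv_cons, ih, Function.iterate_succ_apply']

theorem CkAt.wordDeriv {l : List Direction} {k : ℕ} {f : Field} {x : Pt}
    (hf : CkAt (k + l.length) f x) : CkAt k (wordDeriv l f) x := by
  induction l generalizing k with
  | nil => exact hf
  | cons i l ih =>
    exact (ih (hf.mono (by simp only [List.length_cons]; omega))).dirDeriv i

theorem wordDeriv_congr {f g : Field} {x : Pt} (h : f =ᶠ[𝓝 x] g) (l : List Direction) :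
    wordDeriv l f =ᶠ[𝓝 x] wordDeriv l g := by
  induction l with
  | nil => exact h
  | cons i l ih => exact dirDeriv_congr i ih

theorem wordDeriv_add {l : List Direction} {f g : Field} {x : Pt} (hf : CkAt l.length f x)
    (hg : CkAt l.length g x) :
    wordDeriv l (fun y => f y + g y) x = wordDeriv l f x + wordDeriv l g x := by
  induction l generalizing x with
  | nil => rfl
  | cons i l ih =>
    rw [List.length_cons, add_comm] at hf hg
    have h : wordDeriv l (fun y => f y + g y) =ᶠ[𝓝 x]
        fun y => wordDeriv l f y + wordDeriv l g y := by
      filter_upwards [hf.eventually, hg.eventually] with y hfy hgy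
      exact ih (hfy.mono (by omega)) (hgy.mono (by omega))
    rw [wordDeriv_cons, (dirDeriv_congr i h).eq_of_nhds, dirDeriv_add i hf.wordDeriv hg.wordDeriv]
    rfl

theorem wordDeriv_const_mul {l : List Direction} {f : Field} {x : Pt} (c : ℂ)
    (hf : CkAt l.length f x) : wordDeriv l (fun y => c * f y) x = c * wordDeriv l f x := by
  induction l generalizing x with
  | nil => rfl
  | cons i l ih =>
    rw [List.length_cons, add_comm] at hf
    have h : wordDeriv l (fun y => c * f y) =ᶠ[𝓝 x] fun y => c * wordDeriv l f y :=
      hf.eventually.mono fun y hfy => ih (hfy.mono (by omega))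
    rw [wordDeriv_cons, (dirDeriv_congr i h).eq_of_nhds, dirDeriv_const_mul i c hf.wordDeriv]
    rfl

/-- The differential operator given by a linear combination of words, a pair `(c, l)` standing
for `c` times the iterated derivative along `l`. -/
def combDeriv (S : List (ℂ × List Direction)) (f : Field) : Field :=
  fun x => (S.map fun s => s.1 * wordDeriv s.2 f x).sum

theorem combDeriv_cons (s : ℂ × List Direction) (S : List (ℂ × List Direction)) (f : Field)
    (x : Pt) : combDeriv (s :: S) f x = s.1 * wordDeriv s.2 f x + combDeriv S f x := rfl

theorem combDeriv_append (S S' : List (ℂ × List Direction)) (f : Field) (x : Pt) :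
    combDeriv (S ++ S') f x = combDeriv S f x + combDeriv S' f x := by
  simp only [combDeriv, List.map_append, List.sum_append]

theorem CkAt.combDeriv {S : List (ℂ × List Direction)} {k : ℕ} {f : Field} {x : Pt}
    (hf : ∀ s ∈ S, CkAt (k + s.2.length) f x) : CkAt k (combDeriv S f) x := by
  induction S with
  | nil => exact CkAt.const 0
  | cons s S ih =>
    rw [List.forall_mem_cons] at hf
    exact (hf.1.wordDeriv.const_mul s.1).add (ih hf.2)

theorem dirDeriv_combDeriv {S : List (ℂ × List Direction)} (i : Direction) {f : Field} {x : Pt}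
    (hf : ∀ s ∈ S, CkAt (1 + s.2.length) f x) :
    dirDeriv i (combDeriv S f) x = combDeriv (S.map fun s => (s.1, i :: s.2)) f x := by
  induction S with
  | nil => exact dirDeriv_const i 0
  | cons s S ih =>
    rw [List.forall_mem_cons] at hf
    rw [List.map_cons, combDeriv_cons, ← ih hf.2, wordDeriv_cons,
      ← dirDeriv_const_mul i s.1 hf.1.wordDeriv]
    exact dirDeriv_add i (hf.1.wordDeriv.const_mul s.1) (CkAt.combDeriv hf.2)

theorem exists_wordDeriv_swap (i j : Direction) (l : List Direction) :
    ∃ S : List (ℂ × List Direction), (∀ s ∈ S, s.2.length < (j :: i :: l).length ∧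
        s.2.count .ρ = (j :: i :: l).count .ρ) ∧
      ∀ {f : Field} {x : Pt}, CkAt (j :: i :: l).length f x →
        wordDeriv (j :: i :: l) f x = wordDeriv (i :: j :: l) f x + combDeriv S f x := by
  have hC {f : Field} {x : Pt} (hf : CkAt (j :: i :: l).length f x) : CkAt 2 (wordDeriv l f) x :=
    CkAt.wordDeriv (hf.mono (by simp only [List.length_cons]; omega))
  by_cases hj : ∀ k, j ≠ .z k
  · refine ⟨[], by simp, fun {f x} hf => ?_⟩
    exact (dirDeriv_comm_of_ne_z hj i (hC hf)).trans (add_zero _).symm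
  by_cases hi : ∀ k, i ≠ .z k
  · refine ⟨[], by simp, fun {f x} hf => ?_⟩
    exact (dirDeriv_comm_of_ne_z hi j (hC hf)).symm.trans (add_zero _).symm
  push Not at hi hj
  obtain ⟨a, rfl⟩ := hi
  obtain ⟨b, rfl⟩ := hj
  obtain ⟨c, k, hk⟩ := exists_dirDeriv_z_commutator b a
  refine ⟨[(c, .z k :: l)], by simp, fun {f x} hf => (hk (hC hf)).trans ?_⟩
  simp [combDeriv, wordDeriv_cons]

/-- Since the frame is closed under commutators, with constant coefficients, and `∂_ρ` is central,
reordering a word costs only shorter words with the same number of letters `∂_ρ`. -/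
theorem exists_wordDeriv_of_perm {l l' : List Direction} (h : l.Perm l') :
    ∃ S : List (ℂ × List Direction),
      (∀ s ∈ S, s.2.length < l.length ∧ s.2.count .ρ = l.count .ρ) ∧
      ∀ {f : Field} {x : Pt}, CkAt l.length f x →
        wordDeriv l f x = wordDeriv l' f x + combDeriv S f x := by
  induction h with
  | nil => exact ⟨[], by simp, fun _ => (add_zero _).symm⟩
  | @cons i l l' h ih =>
    obtain ⟨S, hS, ih⟩ := ih
    refine ⟨S.map fun s => (s.1, i :: s.2), ?_, fun {f x} hf => ?_⟩
    · simp only [List.forall_mem_map, List.length_cons, List.count_cons]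
      exact fun s hs => ⟨by have := (hS s hs).1; omega, by rw [(hS s hs).2]⟩
    rw [List.length_cons, add_comm] at hf
    have hcongr : wordDeriv l f =ᶠ[𝓝 x] fun y => wordDeriv l' f y + combDeriv S f y :=
      hf.eventually.mono fun y hfy => ih (hfy.mono (by omega))
    have hCS : ∀ s ∈ S, CkAt (1 + s.2.length) f x :=
      fun s hs => hf.mono (by have := (hS s hs).1; omega)
    rw [wordDeriv_cons, (dirDeriv_congr i hcongr).eq_of_nhds,
      dirDeriv_add i (CkAt.wordDeriv (h.length_eq ▸ hf)) (CkAt.combDeriv hCS),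
      dirDeriv_combDeriv i hCS]
    rfl
  | swap i j l => exact exists_wordDeriv_swap i j l
  | @trans l l' l'' h _ ih ih' =>
    obtain ⟨S, hS, ih⟩ := ih
    obtain ⟨S', hS', ih'⟩ := ih'
    rw [← h.length_eq, ← h.count_eq] at hS'
    rw [← h.length_eq] at ih'
    refine ⟨S' ++ S, List.forall_mem_append.2 ⟨hS', hS⟩, fun {f x} hf => ?_⟩
    rw [ih hf, ih' hf, combDeriv_append, add_assoc]

/-- The word of the monomial `∂_ρ^{n.1} ∂_τ^{n.2.1} Z^α ∂_ρ^p`. -/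
def mixedWord (p : ℕ) (n : ℕ × ℕ × ℕ × ℕ × ℕ) : List Direction :=
  .replicate n.1 .ρ ++ (.replicate n.2.1 .τ ++ (.replicate n.2.2.1 (.z 0) ++
    (.replicate n.2.2.2.1 (.z 1) ++ (.replicate n.2.2.2.2 (.z 2) ++ .replicate p .ρ))))

theorem D_iterate_dρ (p : ℕ) (n : ℕ × ℕ × ℕ × ℕ × ℕ) (f : Field) :
    D n (dρ^[p] f) = wordDeriv (mixedWord p n) f := by
  simp only [mixedWord, wordDeriv_append, wordDeriv_replicate]
  rfl

theorem count_mixedWord (p : ℕ) (n : ℕ × ℕ × ℕ × ℕ × ℕ) (i : Direction) :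
    (mixedWord p n).count i = match i with
      | .τ => n.2.1 | .ρ => n.1 + p | .z 0 => n.2.2.1 | .z 1 => n.2.2.2.1 | .z 2 => n.2.2.2.2 := by
  rcases i with _ | _ | j
  · simp [mixedWord, List.count_replicate]
  · simp [mixedWord, List.count_replicate]
  · fin_cases j <;> simp [mixedWord, List.count_replicate]

theorem length_mixedWord (p : ℕ) (n : ℕ × ℕ × ℕ × ℕ × ℕ) :
    (mixedWord p n).length = p + (n.1 + n.2.1 + (n.2.2.1 + n.2.2.2.1 + n.2.2.2.2)) := by
  simp only [mixedWord, List.length_append, List.length_replicate]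
  omega

theorem length_mixedWord_le {p m : ℕ} {n : ℕ × ℕ × ℕ × ℕ × ℕ} (hn : n ∈ indices m) :
    (mixedWord p n).length ≤ p + m :=
  (length_mixedWord p n).trans_le (Nat.add_le_add_left (mem_indices.1 hn) p)

theorem exists_perm_mixedWord {p : ℕ} {l : List Direction} (hp : p ≤ l.count .ρ) :
    ∃ n, l.Perm (mixedWord p n) := by
  refine ⟨(l.count .ρ - p, l.count .τ, l.count (.z 0), l.count (.z 1), l.count (.z 2)), ?_⟩
  refine List.perm_iff_count.2 fun i => ?_
  rw [count_mixedWord]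
  rcases i with _ | _ | j
  · rfl
  · exact (Nat.sub_add_cancel hp).symm
  · fin_cases j <;> rfl

/-- The squared Euclidean length of the vector of all monomial derivatives of order at most `m` of
`∂_ρ^p f`; it is the real number whose image in `[0, ∞]` is `density m (∂_ρ^p f)`. -/
def energy (p m : ℕ) (f : Field) (x : Pt) : ℝ :=
  ∑ n ∈ indices m, ‖wordDeriv (mixedWord p n) f x‖ ^ 2

theorem energy_nonneg (p m : ℕ) (f : Field) (x : Pt) : 0 ≤ energy p m f x :=
  Finset.sum_nonneg fun _ _ => sq_nonneg _

theorem density_iterate_dρ (p m : ℕ) (f : Field) (x : Pt) :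
    density m (dρ^[p] f) x = ENNReal.ofReal (energy p m f x) := by
  simp only [density, energy, D_iterate_dρ, ENNReal.ofReal_sum_of_nonneg fun _ _ => sq_nonneg _,
    ENNReal.ofReal_pow (norm_nonneg _), ofReal_norm]

theorem ckAt_wordDeriv_mixedWord {p m k : ℕ} {n : ℕ × ℕ × ℕ × ℕ × ℕ} (hn : n ∈ indices m)
    {f : Field} {x : Pt} (hf : CkAt (p + m + k) f x) : CkAt k (wordDeriv (mixedWord p n) f) x :=
  CkAt.wordDeriv (hf.mono (by have := length_mixedWord_le (p := p) hn; omega))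

/-- The operator `T` is pointwise controlled by the derivatives entering `energy p m`. -/
def DominatedByEnergy (p m : ℕ) (T : Field → Field) : Prop :=
  ∃ C : ℝ, 0 ≤ C ∧ ∀ {f : Field} {x : Pt}, CkAt (p + m) f x → ‖T f x‖ ^ 2 ≤ C * energy p m f x

namespace DominatedByEnergy

variable {p m : ℕ} {T T' : Field → Field}

theorem add (hT : DominatedByEnergy p m T) (hT' : DominatedByEnergy p m T') :
    DominatedByEnergy p m fun f x => T f x + T' f x := by
  obtain ⟨C, hC, hT⟩ := hT
  obtain ⟨C', hC', hT'⟩ := hT'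
  refine ⟨2 * (C + C'), by positivity, fun {f x} hf => ?_⟩
  calc ‖T f x + T' f x‖ ^ 2 ≤ (‖T f x‖ + ‖T' f x‖) ^ 2 := by gcongr; exact norm_add_le _ _
    _ ≤ 2 * (‖T f x‖ ^ 2 + ‖T' f x‖ ^ 2) := add_sq_le
    _ ≤ 2 * (C + C') * energy p m f x := by linarith [hT hf, hT' hf]

theorem const_mul (c : ℂ) (hT : DominatedByEnergy p m T) :
    DominatedByEnergy p m fun f x => c * T f x := by
  obtain ⟨C, hC, hT⟩ := hT
  refine ⟨‖c‖ ^ 2 * C, by positivity, fun {f x} hf => ?_⟩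
  rw [norm_mul, mul_pow, mul_assoc]
  exact mul_le_mul_of_nonneg_left (hT hf) (by positivity)

theorem combDeriv {S : List (ℂ × List Direction)}
    (hS : ∀ s ∈ S, DominatedByEnergy p m (wordDeriv s.2)) :
    DominatedByEnergy p m (combDeriv S) := by
  induction S with
  | nil => exact ⟨0, le_rfl, fun {f x} _ => by simp [FGauge.combDeriv]⟩
  | cons s S ih =>
    rw [List.forall_mem_cons] at hS
    exact (hS.1.const_mul s.1).add (ih hS.2)

theorem wordDeriv {l : List Direction} (hp : p ≤ l.count .ρ) (hl : l.length ≤ p + m) :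
    DominatedByEnergy p m (wordDeriv l) := by
  induction hk : l.length using Nat.strong_induction_on generalizing l with
  | _ k ih =>
    subst hk
    obtain ⟨n, hn⟩ := exists_perm_mixedWord hp
    obtain ⟨S, hS, hperm⟩ := exists_wordDeriv_of_perm hn
    have hmem : n ∈ indices m := by
      rw [hn.length_eq, length_mixedWord] at hl
      exact mem_indices.2 (by omega)
    have hmain : DominatedByEnergy p m (FGauge.wordDeriv (mixedWord p n)) :=
      ⟨1, zero_le_one, fun {f x} _ => (Finset.single_le_sum
        (f := fun n => ‖FGauge.wordDeriv (mixedWord p n) f x‖ ^ 2)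
        (fun _ _ => sq_nonneg _) hmem).trans (one_mul _).ge⟩
    have hrest : DominatedByEnergy p m (FGauge.combDeriv S) := combDeriv fun s hs =>
      ih _ (hS s hs).1 (by rw [(hS s hs).2]; exact hp) ((hS s hs).1.le.trans hl) rfl
    obtain ⟨C, hC, hbound⟩ := hmain.add hrest
    exact ⟨C, hC, fun {f x} hf => by rw [hperm (hf.mono hl)]; exact hbound hf⟩

end DominatedByEnergy

theorem exists_wordDeriv_mixedWord_Z {p m : ℕ} {n : ℕ × ℕ × ℕ × ℕ × ℕ} (hn : n ∈ indices m)
    (j : Fin 3) : ∃ T, DominatedByEnergy p m T ∧ ∀ {f : Field} {x : Pt}, CkAt (p + m + 1) f x →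
      wordDeriv (mixedWord p n) (Z j f) x = Z j (wordDeriv (mixedWord p n) f) x + T f x := by
  have hperm : (mixedWord p n ++ [Direction.z j]).Perm (.z j :: mixedWord p n) :=
    List.perm_append_comm
  obtain ⟨S, hS, hcomm⟩ := exists_wordDeriv_of_perm hperm
  rw [mem_indices] at hn
  have hlen : (mixedWord p n ++ [Direction.z j]).length ≤ p + m + 1 := by
    rw [List.length_append, length_mixedWord, List.length_singleton]; omega
  refine ⟨combDeriv S, .combDeriv fun s hs => .wordDeriv ?_ ?_, fun {f x} hf => ?_⟩
  · rw [(hS s hs).2, List.count_append, count_mixedWord]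
    exact (Nat.le_add_left p n.1).trans (Nat.le_add_right _ _)
  · have := (hS s hs).1; omega
  · exact (congrFun (wordDeriv_append _ _ f) x).symm.trans (hcomm (hf.mono hlen))

/-- The derivative along the vector field with components `V` in the frame. -/
def vecDeriv (V : Direction → Field) (f : Field) : Field := fun x => ∑ i, V i x * dirDeriv i f x

section VecDeriv

variable (V : Direction → Field) {f g : Field} {x : Pt}

theorem vecDeriv_congr (h : f =ᶠ[𝓝 x] g) : vecDeriv V f x = vecDeriv V g x :=
  Finset.sum_congr rfl fun i _ => by rw [(dirDeriv_congr i h).eq_of_nhds]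

theorem vecDeriv_add_const_mul (c : ℂ) (hf : CkAt 1 f x) (hg : CkAt 1 g x) :
    vecDeriv V (fun y => f y + c * g y) x = vecDeriv V f x + c * vecDeriv V g x := by
  simp only [vecDeriv, dirDeriv_add _ hf (hg.const_mul c), dirDeriv_const_mul _ c hg, mul_add,
    Finset.sum_add_distrib, Finset.mul_sum, mul_left_comm]

theorem vecDeriv_mul (hf : CkAt 1 f x) (hg : CkAt 1 g x) :
    vecDeriv V (fun y => f y * g y) x = vecDeriv V f x * g x + f x * vecDeriv V g x := by
  simp only [vecDeriv, dirDeriv_mul _ hf hg, Finset.sum_mul, Finset.mul_sum,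
    ← Finset.sum_add_distrib]
  exact Finset.sum_congr rfl fun i _ => by ring

theorem vecDeriv_sum {ι : Type*} {s : Finset ι} {f : ι → Field} (hf : ∀ j ∈ s, CkAt 1 (f j) x) :
    vecDeriv V (fun y => ∑ j ∈ s, f j y) x = ∑ j ∈ s, vecDeriv V (f j) x := by
  simp only [vecDeriv, dirDeriv_sum _ hf, Finset.mul_sum]
  exact Finset.sum_comm

theorem vecDeriv_conj (hf : CkAt 1 f x) : vecDeriv V (fun y => (starRingEnd ℂ) (f y)) x =
    (starRingEnd ℂ) (vecDeriv (fun i y => (starRingEnd ℂ) (V i y)) f x) := by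
  simp only [vecDeriv, dirDeriv_conj _ hf, map_sum, map_mul, Complex.conj_conj]

theorem CkAt.vecDeriv {k : ℕ} {V : Direction → Field} (hV : ∀ i, CkAt k (V i) x)
    (hf : CkAt (k + 1) f x) : CkAt k (vecDeriv V f) x :=
  CkAt.sum fun i _ => (hV i).mul (hf.dirDeriv i)

theorem dirDeriv_vecDeriv (i : Direction) (hV : ∀ j, CkAt 1 (V j) x) (hf : CkAt 2 f x) :
    dirDeriv i (vecDeriv V f) x =
      ∑ j, (dirDeriv i (V j) x * dirDeriv j f x + V j x * dirDeriv i (dirDeriv j f) x) := by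
  have h : dirDeriv i (vecDeriv V f) x = ∑ j, dirDeriv i (fun y => V j y * dirDeriv j f y) x :=
    dirDeriv_sum i fun j _ => (hV j).mul (hf.dirDeriv j)
  rw [h]
  exact Finset.sum_congr rfl fun j _ => dirDeriv_mul i (hV j) (hf.dirDeriv j)

end VecDeriv

theorem sum_direction (a : Direction → ℂ) :
    ∑ i, a i = a .τ + a .ρ + (a (.z 0) + a (.z 1) + a (.z 2)) := by
  have h : (Finset.univ : Finset Direction) = {.τ, .ρ, .z 0, .z 1, .z 2} := by decide
  rw [h]
  simp only [Finset.mem_insert, Finset.mem_singleton, reduceCtorEq, or_self, not_false_eq_true,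
    Finset.sum_insert, Direction.z.injEq, Fin.reduceEq, Finset.sum_singleton]
  ring

theorem CkAt.τ {k : ℕ} {x : Pt} : CkAt k (fun y => (y.1 : ℂ)) x :=
  CkAt.of_contDiff (F := fun y => (y.1 : ℂ)) (Complex.ofRealCLM.contDiff.comp contDiff_fst)

theorem CkAt.ρ {k : ℕ} {x : Pt} : CkAt k (fun y => (y.2.1 : ℂ)) x :=
  CkAt.of_contDiff (F := fun y => (y.2 : ℂ)) (Complex.ofRealCLM.contDiff.comp contDiff_snd)

theorem dirDeriv_τ (i : Direction) (x : Pt) :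
    dirDeriv i (fun y => (y.1 : ℂ)) x = if i = .τ then 1 else 0 := by
  cases i with
  | τ => exact (Complex.ofRealCLM.hasDerivAt (x := x.1)).deriv
  | ρ => simp [dirDeriv, dρ]
  | z j => simp [dirDeriv, Z]

theorem dirDeriv_ρ (i : Direction) (x : Pt) :
    dirDeriv i (fun y => (y.2.1 : ℂ)) x = if i = .ρ then 1 else 0 := by
  cases i with
  | τ => simp [dirDeriv, dτ]
  | ρ => exact (Complex.ofRealCLM.hasDerivAt (x := x.2.1)).deriv
  | z j => simp [dirDeriv, Z]

/-- The components of the vector field `(1 + στ) ∂_τ - σ ρ ∂_ρ`. -/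
def transportField (σ : ℝ) : Direction → Field
  | .τ => fun x => 1 + σ * x.1
  | .ρ => fun x => (-σ : ℂ) * x.2.1
  | .z _ => fun _ => 0

/-- The transport operator `(1 + στ) ∂_τ - σ ρ ∂_ρ`; the hierarchy involves `σ = 1` and
`σ = -1`. -/
def transport (σ : ℝ) : Field → Field := vecDeriv (transportField σ)

theorem transport_apply (σ : ℝ) (f : Field) (x : Pt) :
    transport σ f x = (1 + σ * x.1) * dτ f x - σ * x.2.1 * dρ f x := by
  simp only [transport, vecDeriv, sum_direction, transportField, dirDeriv]
  ring

theorem CkAt.transportField {k : ℕ} (σ : ℝ) (i : Direction) (x : Pt) :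
    CkAt k (transportField σ i) x := by
  cases i with
  | τ => exact (CkAt.const 1).add (CkAt.τ.const_mul σ)
  | ρ => exact CkAt.ρ.const_mul (-σ)
  | z j => exact CkAt.const 0

theorem CkAt.transport {k : ℕ} {f : Field} {x : Pt} (σ : ℝ) (hf : CkAt (k + 1) f x) :
    CkAt k (transport σ f) x :=
  CkAt.vecDeriv (fun i => CkAt.transportField σ i x) hf

theorem dirDeriv_transportField (σ : ℝ) (i j : Direction) (x : Pt) :
    dirDeriv i (transportField σ j) x =
      if i = j then (if i = .τ then (σ : ℂ) else 0) - (if i = .ρ then (σ : ℂ) else 0) else 0 := by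
  cases j with
  | τ =>
    have h : dirDeriv i (transportField σ .τ) x = _ :=
      dirDeriv_add i (CkAt.const 1) (CkAt.τ.const_mul σ)
    rw [h, dirDeriv_const, dirDeriv_const_mul i σ CkAt.τ, dirDeriv_τ]
    cases i <;> simp
  | ρ =>
    have h : dirDeriv i (transportField σ .ρ) x = _ := dirDeriv_const_mul i (-σ : ℂ) CkAt.ρ
    rw [h, dirDeriv_ρ]
    cases i <;> simp
  | z k =>
    have h : dirDeriv i (transportField σ (.z k)) x = 0 := dirDeriv_const i 0
    rw [h]
    cases i <;> simp

theorem dirDeriv_transport (σ : ℝ) (i : Direction) {f : Field} {x : Pt} (hf : CkAt 2 f x) :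
    dirDeriv i (transport σ f) x = transport σ (dirDeriv i f) x +
      ((if i = .τ then (σ : ℂ) else 0) - (if i = .ρ then (σ : ℂ) else 0)) * dirDeriv i f x := by
  have hcomm (j : Direction) : transportField σ j x * dirDeriv i (dirDeriv j f) x =
      transportField σ j x * dirDeriv j (dirDeriv i f) x := by
    cases j with
    | τ => rw [dirDeriv_comm_of_ne_z (by simp) i hf]
    | ρ => rw [dirDeriv_comm_of_ne_z (by simp) i hf]
    | z k => simp only [transportField, zero_mul]
  rw [transport, dirDeriv_vecDeriv _ i (fun j => CkAt.transportField σ j x) hf]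
  simp only [dirDeriv_transportField, hcomm, Finset.sum_add_distrib, ite_mul, zero_mul,
    Finset.sum_ite_eq, Finset.mem_univ, if_true]
  exact add_comm _ _

theorem wordDeriv_transport (σ : ℝ) {l : List Direction} {f : Field} {x : Pt}
    (hf : CkAt (l.length + 1) f x) : wordDeriv l (transport σ f) x =
      transport σ (wordDeriv l f) x + σ * (l.count .τ - l.count .ρ) * wordDeriv l f x := by
  induction l generalizing x with
  | nil => simp [wordDeriv]
  | cons i l ih =>
    have hf' : CkAt (2 + l.length) f x := hf.mono (by simp only [List.length_cons]; omega)
    have hw : CkAt 2 (wordDeriv l f) x := hf'.wordDeriv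
    have h : wordDeriv l (transport σ f) =ᶠ[𝓝 x] fun y =>
        transport σ (wordDeriv l f) y + σ * (l.count .τ - l.count .ρ) * wordDeriv l f y :=
      hf'.eventually.mono fun y hfy => ih (hfy.mono (by omega))
    rw [wordDeriv_cons, (dirDeriv_congr i h).eq_of_nhds,
      dirDeriv_add i (hw.transport σ) ((hw.mono one_le_two).const_mul _),
      dirDeriv_transport σ i hw, dirDeriv_const_mul i _ (hw.mono one_le_two), wordDeriv_cons,
      List.count_cons, List.count_cons]
    cases i <;>
      simp only [reduceCtorEq, if_true, if_false, beq_iff_eq, BEq.rfl, Nat.cast_add,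
        Nat.cast_one, Nat.cast_zero] <;>
      ring

/-- The components of the vector field `-(Z₂ + c Z₁)`. -/
def XopField (c : ℂ) : Direction → Field
  | .z 0 => fun _ => -c
  | .z 1 => fun _ => -1
  | _ => fun _ => 0

/-- The operator `-(Z₂ + c Z₁)`, which is `X₊` for `c = i` and `X₋` for `c = -i`. -/
def Xop (c : ℂ) : Field → Field := vecDeriv (XopField c)

theorem Xop_apply (c : ℂ) (f : Field) (x : Pt) : Xop c f x = -(Z 1 f x + c * Z 0 f x) := by
  simp only [Xop, vecDeriv, sum_direction, XopField, dirDeriv]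
  ring

theorem Xplus_eq_Xop (f : Field) : Xplus f = Xop Complex.I f :=
  funext fun x => (Xop_apply Complex.I f x).symm

theorem Xminus_eq_Xop (f : Field) : Xminus f = Xop (-Complex.I) f :=
  funext fun x => by rw [Xop_apply, Xminus]; ring

theorem CkAt.Xop {k : ℕ} {f : Field} {x : Pt} (c : ℂ) (hf : CkAt (k + 1) f x) :
    CkAt k (Xop c f) x := by
  refine CkAt.vecDeriv (fun i => ?_) hf
  unfold XopField
  split <;> exact CkAt.const _

theorem Xop_conj (c : ℂ) {f : Field} {x : Pt} (hf : CkAt 1 f x) :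
    Xop c (fun y => (starRingEnd ℂ) (f y)) x =
      (starRingEnd ℂ) (Xop ((starRingEnd ℂ) c) f x) := by
  rw [Xop, vecDeriv_conj _ hf]
  simp only [Xop, vecDeriv, sum_direction, XopField, map_neg, map_one, map_zero]

theorem transport_conj (σ : ℝ) {f : Field} {x : Pt} (hf : CkAt 1 f x) :
    transport σ (fun y => (starRingEnd ℂ) (f y)) x = (starRingEnd ℂ) (transport σ f x) := by
  rw [transport, vecDeriv_conj _ hf]
  simp only [vecDeriv, sum_direction, transportField, map_add, map_neg, map_mul, map_one,
    Complex.conj_ofReal, map_zero]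

theorem exists_wordDeriv_mixedWord_Xop {p m : ℕ} {n : ℕ × ℕ × ℕ × ℕ × ℕ} (hn : n ∈ indices m)
    (c : ℂ) : ∃ T, DominatedByEnergy p m T ∧ ∀ {f : Field} {x : Pt}, CkAt (p + m + 1) f x →
      wordDeriv (mixedWord p n) (Xop c f) x = Xop c (wordDeriv (mixedWord p n) f) x + T f x := by
  obtain ⟨T₀, hT₀, hZ₀⟩ := exists_wordDeriv_mixedWord_Z (p := p) hn 0
  obtain ⟨T₁, hT₁, hZ₁⟩ := exists_wordDeriv_mixedWord_Z (p := p) hn 1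
  refine ⟨_, (hT₁.add (hT₀.const_mul c)).const_mul (-1), fun {f x} hf => ?_⟩
  have hC (j : Fin 3) : CkAt (mixedWord p n).length (Z j f) x :=
    (hf.dirDeriv (.z j)).mono (length_mixedWord_le hn)
  have hXop : Xop c f = fun y => (-1) * (Z 1 f y + c * Z 0 f y) :=
    funext fun y => by rw [Xop_apply, neg_one_mul]
  rw [hXop, wordDeriv_const_mul _ ((hC 1).add ((hC 0).const_mul c)),
    wordDeriv_add (hC 1) ((hC 0).const_mul c), wordDeriv_const_mul c (hC 0), hZ₀ hf, hZ₁ hf,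
    Xop_apply]
  ring

/-- The sum of the products of corresponding derivatives of `f` and `g`, whose diagonal is the
energy. -/
def cross (p m : ℕ) (f g : Field) : Field := fun x =>
  ∑ n ∈ indices m, wordDeriv (mixedWord p n) f x * (starRingEnd ℂ) (wordDeriv (mixedWord p n) g x)

theorem cross_self (p m : ℕ) (f : Field) (x : Pt) : cross p m f f x = energy p m f x := by
  simp only [cross, energy, Complex.mul_conj, Complex.normSq_eq_norm_sq, Complex.ofReal_sum]

section Cross

variable {p m : ℕ} {f g : Field} {x : Pt}

theorem CkAt.cross {k : ℕ} (hf : CkAt (p + m + k) f x) (hg : CkAt (p + m + k) g x) :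
    CkAt k (cross p m f g) x :=
  CkAt.sum fun _ hn => (ckAt_wordDeriv_mixedWord hn hf).mul (ckAt_wordDeriv_mixedWord hn hg).conj

theorem CkAt.energy {k : ℕ} (hf : CkAt (p + m + k) f x) :
    CkAt k (fun y => (energy p m f y : ℂ)) x :=
  funext (cross_self p m f) ▸ hf.cross hf

theorem vecDeriv_cross (V : Direction → Field) (hf : CkAt (p + m + 1) f x)
    (hg : CkAt (p + m + 1) g x) : vecDeriv V (cross p m f g) x = ∑ n ∈ indices m,
      (vecDeriv V (wordDeriv (mixedWord p n) f) x *
          (starRingEnd ℂ) (wordDeriv (mixedWord p n) g x) +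
        wordDeriv (mixedWord p n) f x *
          vecDeriv V (fun y => (starRingEnd ℂ) (wordDeriv (mixedWord p n) g y)) x) := by
  have hf' {n} (hn : n ∈ indices m) := ckAt_wordDeriv_mixedWord hn hf
  have hg' {n} (hn : n ∈ indices m) := (ckAt_wordDeriv_mixedWord hn hg).conj
  exact (vecDeriv_sum V fun n hn => (hf' hn).mul (hg' hn)).trans
    (Finset.sum_congr rfl fun n hn => vecDeriv_mul V (hf' hn) (hg' hn))

theorem re_transport_energy (σ : ℝ) (hf : CkAt (p + m + 1) f x) :
    (transport σ (fun y => (energy p m f y : ℂ)) x).re = ∑ n ∈ indices m,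
      2 * ((starRingEnd ℂ) (wordDeriv (mixedWord p n) f x) *
        transport σ (wordDeriv (mixedWord p n) f) x).re := by
  rw [← funext (cross_self p m f), transport, vecDeriv_cross _ hf hf, Complex.re_sum]
  refine Finset.sum_congr rfl fun n hn => ?_
  rw [← transport, transport_conj σ (ckAt_wordDeriv_mixedWord hn hf), Complex.add_re,
    ← Complex.conj_re (wordDeriv _ f x * _), map_mul, Complex.conj_conj, two_mul, mul_comm]

theorem re_Xop_cross (hf : CkAt (p + m + 1) f x) (hg : CkAt (p + m + 1) g x) :
    (Xop Complex.I (cross p m f g) x).re = ∑ n ∈ indices m,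
      (((starRingEnd ℂ) (wordDeriv (mixedWord p n) f x) *
          Xop (-Complex.I) (wordDeriv (mixedWord p n) g) x).re +
        ((starRingEnd ℂ) (wordDeriv (mixedWord p n) g x) *
          Xop Complex.I (wordDeriv (mixedWord p n) f) x).re) := by
  rw [Xop, vecDeriv_cross _ hf hg, Complex.re_sum]
  refine Finset.sum_congr rfl fun n hn => ?_
  rw [← Xop, Xop_conj _ (ckAt_wordDeriv_mixedWord hn hg), Complex.conj_I, Complex.add_re,
    ← Complex.conj_re (wordDeriv _ f x * _), map_mul, Complex.conj_conj, mul_comm (Xop _ _ _),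
    add_comm]

end Cross

theorem two_mul_re_le (a b : ℂ) {k : ℝ} (hk : 0 < k) :
    2 * ((starRingEnd ℂ) a * b).re ≤ k * ‖a‖ ^ 2 + k⁻¹ * ‖b‖ ^ 2 := by
  have hre : ((starRingEnd ℂ) a * b).re ≤ ‖a‖ * ‖b‖ :=
    (Complex.re_le_norm _).trans_eq (by rw [norm_mul, Complex.norm_conj])
  have hsq : k * ‖a‖ ^ 2 + k⁻¹ * ‖b‖ ^ 2 - 2 * (‖a‖ * ‖b‖) = k⁻¹ * (k * ‖a‖ - ‖b‖) ^ 2 := by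
    field_simp
    ring
  have hnonneg : 0 ≤ k⁻¹ * (k * ‖a‖ - ‖b‖) ^ 2 := by positivity
  linarith

/-- The pair of equations `transport 1 u = c₁ u + X₋ v` and `transport (-1) v = c₂ v + X₊ u` at
a point. The hierarchy is a combination of two such pairs. -/
structure TransportPairAt (c₁ c₂ : ℝ) (u v : Field) (x : Pt) : Prop where
  fst : transport 1 u x = c₁ * u x + Xop (-Complex.I) v x
  snd : transport (-1) v x = c₂ * v x + Xop Complex.I u x

theorem exists_transport_wordDeriv_mixedWord {p m : ℕ} {n : ℕ × ℕ × ℕ × ℕ × ℕ}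
    (hn : n ∈ indices m) (e : ℂ) : ∃ T, DominatedByEnergy p m T ∧
      ∀ {σ c : ℝ} {u v : Field} {x : Pt}, CkAt (p + m + 1) u x → CkAt (p + m + 1) v x →
        (transport σ u =ᶠ[𝓝 x] fun y => c * u y + Xop e v y) →
        transport σ (wordDeriv (mixedWord p n) u) x =
          ((c + σ * (n.1 + p - n.2.1) : ℝ) : ℂ) * wordDeriv (mixedWord p n) u x +
            Xop e (wordDeriv (mixedWord p n) v) x + T v x := by
  obtain ⟨T, hT, hXop⟩ := exists_wordDeriv_mixedWord_Xop (p := p) hn e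
  refine ⟨T, hT, fun {σ c u v x} hu hv h => ?_⟩
  have hlen := length_mixedWord_le (p := p) hn
  have hu' : CkAt (mixedWord p n).length u x := hu.mono (hlen.trans (Nat.le_succ _))
  have htransport := wordDeriv_transport σ (hu.mono (Nat.succ_le_succ hlen))
  rw [(wordDeriv_congr h _).eq_of_nhds, wordDeriv_add (hu'.const_mul _) ((hv.Xop e).mono hlen),
    wordDeriv_const_mul _ hu', hXop hv, count_mixedWord, count_mixedWord] at htransport
  push_cast at htransport ⊢
  linear_combination -htransport

theorem re_conj_mul_real_mul (a : ℂ) (r : ℝ) : ((starRingEnd ℂ) a * (r * a)).re = r * ‖a‖ ^ 2 := by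
  rw [mul_left_comm, Complex.re_ofReal_mul, mul_comm _ a, Complex.mul_conj,
    Complex.normSq_eq_norm_sq, Complex.ofReal_re]

theorem exists_energy_inequality_index {p m : ℕ} (hpm : m + 1 < p) {n : ℕ × ℕ × ℕ × ℕ × ℕ}
    (hn : n ∈ indices m) : ∃ Q, 0 ≤ Q ∧ ∀ {k : ℝ}, 0 < k → ∀ {c₁ c₂ : ℝ}, c₁ ≤ 0 → c₂ ≤ 1 →
      ∀ {u v : Field} {x : Pt}, CkAt (p + m + 1) u x → CkAt (p + m + 1) v x →
      (∀ᶠ y in 𝓝 x, TransportPairAt c₁ c₂ u v y) →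
      2 * ((starRingEnd ℂ) (wordDeriv (mixedWord p n) u x) *
          transport 1 (wordDeriv (mixedWord p n) u) x).re +
        2 * ((starRingEnd ℂ) (wordDeriv (mixedWord p n) v x) *
          transport (-1) (wordDeriv (mixedWord p n) v) x).re ≤
      (2 * (p + m) + k) * ‖wordDeriv (mixedWord p n) u x‖ ^ 2 -
        3 / 2 * ‖wordDeriv (mixedWord p n) v x‖ ^ 2 +
        Q * (k⁻¹ * energy p m v x + 2 * energy p m u x) +
        2 * (((starRingEnd ℂ) (wordDeriv (mixedWord p n) u x) *
            Xop (-Complex.I) (wordDeriv (mixedWord p n) v) x).re +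
          ((starRingEnd ℂ) (wordDeriv (mixedWord p n) v x) *
            Xop Complex.I (wordDeriv (mixedWord p n) u) x).re) := by
  obtain ⟨T, ⟨C, hC, hT⟩, hU⟩ := exists_transport_wordDeriv_mixedWord (p := p) hn (-Complex.I)
  obtain ⟨T', ⟨C', hC', hT'⟩, hV⟩ := exists_transport_wordDeriv_mixedWord (p := p) hn Complex.I
  refine ⟨C + C', add_nonneg hC hC', fun {k} hk {c₁ c₂} hc₁ hc₂ {u v x} hu hv h => ?_⟩
  rw [hU hu hv (h.mono fun _ hy => hy.fst), hV hv hu (h.mono fun _ hy => hy.snd)]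
  simp only [mul_add, Complex.add_re, re_conj_mul_real_mul]
  set U := wordDeriv (mixedWord p n) u x
  set V := wordDeriv (mixedWord p n) v x
  have hT := hT (hv.mono (Nat.le_succ _))
  have hT' := hT' (hu.mono (Nat.le_succ _))
  have young := two_mul_re_le U (T v x) hk
  have young' := two_mul_re_le V (T' u x) one_half_pos
  have hτ : (n.1 : ℝ) + n.2.1 ≤ m := by
    exact_mod_cast (by have := mem_indices.1 hn; omega : n.1 + n.2.1 ≤ m)
  have hp : (m : ℝ) + 2 ≤ p := by exact_mod_cast hpm
  have hcoeff : (c₁ + 1 * (n.1 + p - n.2.1)) * ‖U‖ ^ 2 ≤ (p + m) * ‖U‖ ^ 2 :=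
    mul_le_mul_of_nonneg_right (by linarith [(n.2.1.cast_nonneg : (0 : ℝ) ≤ _)]) (sq_nonneg _)
  have hcoeff' : (c₂ + -1 * (n.1 + p - n.2.1)) * ‖V‖ ^ 2 ≤ -1 * ‖V‖ ^ 2 :=
    mul_le_mul_of_nonneg_right (by linarith [(n.1.cast_nonneg : (0 : ℝ) ≤ _)]) (sq_nonneg _)
  have herror : k⁻¹ * ‖T v x‖ ^ 2 ≤ k⁻¹ * ((C + C') * energy p m v x) := by
    gcongr
    nlinarith [energy_nonneg p m v x]
  have herror' : ‖T' u x‖ ^ 2 ≤ (C + C') * energy p m u x := by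
    nlinarith [energy_nonneg p m u x]
  rw [one_div, inv_inv] at young'
  linarith

theorem exists_energy_inequality {p m : ℕ} (hpm : m + 1 < p) : ∃ C, 0 ≤ C ∧
    ∀ {c₁ c₂ : ℝ}, c₁ ≤ 0 → c₂ ≤ 1 → ∀ {u v : Field} {x : Pt},
      CkAt (p + m + 1) u x → CkAt (p + m + 1) v x →
      (∀ᶠ y in 𝓝 x, TransportPairAt c₁ c₂ u v y) →
      (transport 1 (fun y => (energy p m u y : ℂ)) x).re +
          (transport (-1) (fun y => (energy p m v y : ℂ)) x).re ≤
        C * energy p m u x - energy p m v x + 2 * (Xop Complex.I (cross p m u v) x).re := by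
  choose! Q hQ hbound using fun n (hn : n ∈ indices m) => exists_energy_inequality_index hpm hn
  set q := ∑ n ∈ indices m, Q n with hq
  have hq0 : 0 ≤ q := Finset.sum_nonneg hQ
  have hk : 0 < 2 * q + 1 := by linarith
  refine ⟨2 * (p + m) + (2 * q + 1) + 2 * q, by positivity,
    fun {c₁ c₂} hc₁ hc₂ {u v x} hu hv h => ?_⟩
  have hsum := Finset.sum_le_sum fun n hn => hbound n hn hk hc₁ hc₂ hu hv h
  rw [Finset.sum_add_distrib, ← re_transport_energy 1 hu, ← re_transport_energy (-1) hv,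
    Finset.sum_add_distrib, Finset.sum_add_distrib, Finset.sum_sub_distrib, ← Finset.mul_sum,
    ← Finset.mul_sum, ← Finset.mul_sum, ← Finset.sum_mul, ← re_Xop_cross hu hv,
    ← energy, ← energy, ← hq] at hsum
  have habsorb : q * (2 * q + 1)⁻¹ ≤ 1 / 2 := by
    rw [← div_eq_mul_inv, div_le_iff₀ hk]; linarith
  nlinarith [energy_nonneg p m v x]

theorem oneParam_add (j : Fin 3) (s t : ℝ) : oneParam j (s + t) = oneParam j s * oneParam j t := by
  apply Subtype.ext
  have hhalf : ((s + t : ℝ) : ℂ) / 2 = (s : ℂ) / 2 + (t : ℂ) / 2 := by push_cast; ring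
  have hI := Complex.I_sq
  simp only [oneParam, Submonoid.coe_mul, oneParamMatrix, hhalf, Complex.sin_add, Complex.cos_add]
  ext a b
  fin_cases j <;> fin_cases a <;> fin_cases b <;>
    simp [pauli, Matrix.mul_apply, Fin.sum_univ_two] <;> grind

theorem flow_add (i : Direction) (x : Pt) (s t : ℝ) :
    flow i x (s + t) = flow i (flow i x s) t := by
  cases i <;> simp [flow, oneParam_add, add_assoc, mul_assoc]

theorem CkAt.hasDerivAt_flow {f : Field} {i : Direction} {x : Pt} {s : ℝ}
    (hf : CkAt 1 f (flow i x s)) :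
    HasDerivAt (fun t => f (flow i x t)) (FGauge.dirDeriv i f (flow i x s)) s := by
  have h := hf.hasDerivAt i
  rw [← sub_self s] at h
  simpa [← flow_add] using HasDerivAt.comp_sub_const s s h

theorem integral_dirDeriv_flow {f : Field} {i : Direction} {x : Pt} {a b : ℝ} (hab : a ≤ b)
    (hf : ∀ s ∈ Icc a b, CkAt 1 f (flow i x s)) :
    ∫ s in a..b, dirDeriv i f (flow i x s) = f (flow i x b) - f (flow i x a) := by
  rw [← uIcc_of_le hab] at hf
  refine intervalIntegral.integral_eq_sub_of_hasDerivAt (f := fun s => f (flow i x s))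
    (fun s hs => (hf s hs).hasDerivAt_flow) (ContinuousOn.intervalIntegrable fun s hs => ?_)
  have hcont : ContinuousAt (dirDeriv i f) (flow i x s) :=
    CkAt.continuousAt (k := 0) ((hf s hs).dirDeriv i)
  exact (hcont.comp (continuous_flow i x).continuousAt).continuousWithinAt

instance : IsProbabilityMeasure haarSU2 := ⟨haarSU2_univ⟩

instance : haarSU2.IsHaarMeasure := by unfold haarSU2; infer_instance

instance : haarSU2.IsMulRightInvariant where
  map_mul_right_eq_self g := by
    have : IsProbabilityMeasure (haarSU2.map (· * g)) :=
      Measure.isProbabilityMeasure_map (measurable_mul_const g).aemeasurable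
    exact Measure.isHaarMeasure_eq_of_isProbabilityMeasure _ _

theorem integral_intervalIntegral_mul_right {h : SU2 → ℂ} (hh : Continuous h) {γ : ℝ → SU2}
    (hγ : Continuous γ) :
    ∫ g, (∫ s in (0 : ℝ)..1, h (g * γ s)) ∂haarSU2 = ∫ g, h g ∂haarSU2 := by
  have hcont : Continuous fun y : SU2 × ℝ => h (y.1 * γ y.2) := by fun_prop
  have hintegrable : Integrable (fun y : SU2 × ℝ => h (y.1 * γ y.2))
      (haarSU2.prod (volume.restrict (Ioc 0 1))) := by
    have hcompact : IntegrableOn (fun y : SU2 × ℝ => h (y.1 * γ y.2)) (univ ×ˢ Icc 0 1)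
        (haarSU2.prod volume) :=
      hcont.continuousOn.integrableOn_compact (isCompact_univ.prod isCompact_Icc)
    have hmono := hcompact.mono_set (prod_mono_right Ioc_subset_Icc_self)
    rwa [IntegrableOn, ← Measure.prod_restrict, Measure.restrict_univ] at hmono
  simp only [intervalIntegral.integral_of_le zero_le_one]
  rw [integral_integral_swap hintegrable]
  simp [integral_mul_right_eq_self]

theorem continuous_section {E : Type*} [TopologicalSpace E] {α β : Type*} [TopologicalSpace α]
    [TopologicalSpace β] {f : α × β → E} {a : α} (hf : ∀ y, ContinuousAt f (a, y)) :
    Continuous fun y => f (a, y) :=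
  continuous_iff_continuousAt.2 fun y => (hf y).comp (Continuous.prodMk_right a).continuousAt

theorem integral_Z_eq_zero {f : Field} {τ ρ : ℝ} (j : Fin 3)
    (hf : ∀ g : SU2, CkAt 1 f (τ, ρ, g)) : ∫ g, Z j f (τ, ρ, g) ∂haarSU2 = 0 := by
  have hslice (h : Field) (hh : ∀ g, ContinuousAt h (τ, ρ, g)) :
      Continuous fun g : SU2 => h (τ, ρ, g) :=
    continuous_iff_continuousAt.2 fun g =>
      ContinuousAt.comp (f := fun g : SU2 => ((τ, ρ, g) : Pt)) (hh g) (by fun_prop)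
  have hcont := hslice f fun g => (hf g).continuousAt
  have hcontZ := hslice (Z j f) fun g => CkAt.continuousAt (k := 0) ((hf g).dirDeriv (.z j))
  have hintegrable {h : SU2 → ℂ} (hh : Continuous h) : Integrable h haarSU2 :=
    hh.integrable_of_hasCompactSupport (HasCompactSupport.of_compactSpace _)
  have hflow (g : SU2) : ∫ s in (0 : ℝ)..1, Z j f (τ, ρ, g * oneParam j s) =
      f (τ, ρ, g * oneParam j 1) - f (τ, ρ, g) := by
    have := integral_dirDeriv_flow (i := .z j) (x := (τ, ρ, g)) zero_le_one fun s _ => hf _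
    simpa only [flow, oneParam_zero, mul_one, dirDeriv] using this
  rw [← integral_intervalIntegral_mul_right hcontZ (continuous_oneParam j)]
  simp only [hflow]
  have hshift : Integrable (fun g => f (τ, ρ, g * oneParam j 1)) haarSU2 :=
    hintegrable (hcont.comp (continuous_mul_const (oneParam j 1)))
  rw [integral_sub hshift (hintegrable hcont),
    integral_mul_right_eq_self (fun g => f (τ, ρ, g)), sub_self]

/-- The measure `dρ dμ` on `[0, P] × SU(2)`. -/
def slice (P : ℝ) : Measure (ℝ × SU2) := (volume.restrict (Icc 0 P)).prod haarSU2

/-- The measure `dτ dρ dμ` on `(a, T) × [0, P] × SU(2)`. The transport equations are only known in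
one-sided neighbourhoods of the ends of the time interval, which are therefore left out. -/
def slab (a T P : ℝ) : Measure Pt := (volume.restrict (Ioo a T)).prod (slice P)

theorem slice_eq_restrict (P : ℝ) :
    slice P = ((volume : Measure ℝ).prod haarSU2).restrict (Icc 0 P ×ˢ univ) := by
  rw [← Measure.prod_restrict, Measure.restrict_univ, slice]

theorem slab_eq_restrict (a T P : ℝ) : slab a T P = dv.restrict (Ioo a T ×ˢ Icc 0 P ×ˢ univ) := by
  rw [slab, slice_eq_restrict, Measure.prod_restrict, dv]

instance (P : ℝ) : SFinite (slice P) := by unfold slice; infer_instance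

instance : IsFiniteMeasureOnCompacts dv := by unfold dv; infer_instance

theorem integrable_slice {P : ℝ} {E : Type*} [NormedAddCommGroup E] {f : ℝ × SU2 → E}
    (hf : Continuous f) : Integrable f (slice P) := by
  rw [slice_eq_restrict]
  exact hf.continuousOn.integrableOn_compact (isCompact_Icc.prod isCompact_univ)

theorem integrable_slab {a T P : ℝ} {E : Type*} [NormedAddCommGroup E] {f : Pt → E}
    (hf : ∀ x : Pt, x.1 ∈ Icc a T → ContinuousAt f x) : Integrable f (slab a T P) := by
  have hcompact : IntegrableOn f (Icc a T ×ˢ (Icc 0 P ×ˢ univ)) dv :=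
    ContinuousOn.integrableOn_compact (isCompact_Icc.prod (isCompact_Icc.prod isCompact_univ))
      fun x hx => (hf x hx.1).continuousWithinAt
  rw [slab_eq_restrict]
  exact hcompact.mono_set (prod_mono_left Ioo_subset_Icc_self)

section Slab

variable {a T P : ℝ} {f : Field} (hf : ∀ x : Pt, x.1 ∈ Icc a T → CkAt 1 f x)
include hf

theorem integrable_slab_dirDeriv (i : Direction) : Integrable (dirDeriv i f) (slab a T P) :=
  integrable_slab fun x hx => CkAt.continuousAt (k := 0) ((hf x hx).dirDeriv i)

theorem integrable_slice_dirDeriv (i : Direction) {τ : ℝ} (hτ : τ ∈ Icc a T) :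
    Integrable (fun y => dirDeriv i f (τ, y)) (slice P) :=
  integrable_slice (continuous_section fun y =>
    CkAt.continuousAt (k := 0) ((hf (τ, y) hτ).dirDeriv i))

theorem integral_slab_dτ (haT : a ≤ T) :
    ∫ x, dτ f x ∂slab a T P = ∫ y, (f (T, y) - f (a, y)) ∂slice P := by
  refine (integral_prod_symm _ (integrable_slab_dirDeriv hf .τ)).trans
    (integral_congr_ae (.of_forall fun y => ?_))
  have hflow := integral_dirDeriv_flow (i := .τ) (x := (0, y)) haT
    fun s hs => hf _ (by rwa [flow, zero_add])
  rw [intervalIntegral.integral_of_le haT, integral_Ioc_eq_integral_Ioo] at hflow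
  simpa only [flow, zero_add] using hflow

theorem integral_slab_dρ (hP : 0 ≤ P) (h0 : ∀ τ ∈ Icc a T, ∀ g, f (τ, 0, g) = 0)
    (hP0 : ∀ τ ∈ Icc a T, ∀ g, f (τ, P, g) = 0) : ∫ x, dρ f x ∂slab a T P = 0 := by
  refine (integral_prod _ (integrable_slab_dirDeriv hf .ρ)).trans
    (setIntegral_eq_zero_of_forall_eq_zero fun τ hτ => ?_)
  replace hτ := Ioo_subset_Icc_self hτ
  refine (integral_prod_symm _ (integrable_slice_dirDeriv hf .ρ hτ)).trans
    (integral_eq_zero_of_ae (.of_forall fun g => ?_))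
  rw [Pi.zero_apply]
  have hflow := integral_dirDeriv_flow (i := .ρ) (x := (τ, 0, g)) hP fun s _ => hf _ hτ
  rw [intervalIntegral.integral_of_le hP, ← integral_Icc_eq_integral_Ioc] at hflow
  simpa only [flow, zero_add, h0 τ hτ g, hP0 τ hτ g, sub_zero] using hflow

theorem integral_slab_Z (j : Fin 3) : ∫ x, Z j f x ∂slab a T P = 0 := by
  refine (integral_prod _ (integrable_slab_dirDeriv hf (.z j))).trans
    (setIntegral_eq_zero_of_forall_eq_zero fun τ hτ => ?_)
  replace hτ := Ioo_subset_Icc_self hτ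
  exact (integral_prod _ (integrable_slice_dirDeriv hf (.z j) hτ)).trans
    (integral_eq_zero_of_ae (.of_forall fun ρ => integral_Z_eq_zero j fun g => hf _ hτ))

theorem integral_slab_Xop (c : ℂ) : ∫ x, Xop c f x ∂slab a T P = 0 := by
  have hintegrable (j : Fin 3) : Integrable (Z j f) (slab a T P) :=
    integrable_slab_dirDeriv hf (.z j)
  simp only [Xop_apply]
  rw [integral_neg, integral_add (hintegrable 1) ((hintegrable 0).const_mul c), integral_const_mul,
    integral_slab_Z hf, integral_slab_Z hf, mul_zero, add_zero, neg_zero]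

/- The vector field of `transport σ` is divergence-free, and tangent to `ρ = 0`. -/
theorem integral_slab_transport (σ : ℝ) (haT : a ≤ T) (hP : 0 ≤ P)
    (hP0 : ∀ τ ∈ Icc a T, ∀ g, f (τ, P, g) = 0) :
    ∫ x, transport σ f x ∂slab a T P =
      (1 + σ * T) * ∫ y, f (T, y) ∂slice P - (1 + σ * a) * ∫ y, f (a, y) ∂slice P := by
  have hcoeff (i : Direction) (x : Pt) (hx : x.1 ∈ Icc a T) :
      CkAt 1 (fun y => transportField σ i y * f y) x := (CkAt.transportField σ i x).mul (hf x hx)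
  have hdiv (x : Pt) (hx : x.1 ∈ Icc a T) : transport σ f x =
      dirDeriv .τ (fun y => transportField σ .τ y * f y) x +
        dirDeriv .ρ (fun y => transportField σ .ρ y * f y) x := by
    rw [dirDeriv_mul .τ (CkAt.transportField σ .τ x) (hf x hx),
      dirDeriv_mul .ρ (CkAt.transportField σ .ρ x) (hf x hx), dirDeriv_transportField,
      dirDeriv_transportField, transport_apply]
    simp only [transportField, dirDeriv]
    push_cast
    ring
  have hslice {τ : ℝ} (hτ : τ ∈ Icc a T) : Integrable (fun y => f (τ, y)) (slice P) :=
    integrable_slice (continuous_section fun y => (hf (τ, y) hτ).continuousAt)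
  have hsplit : ∫ x, transport σ f x ∂slab a T P =
      ∫ x, (dirDeriv .τ (fun y => transportField σ .τ y * f y) x +
        dirDeriv .ρ (fun y => transportField σ .ρ y * f y) x) ∂slab a T P := integral_congr_ae (by
    rw [slab_eq_restrict]
    exact (ae_restrict_iff' (measurableSet_Ioo.prod (measurableSet_Icc.prod .univ))).2
      (.of_forall fun x hx => hdiv x (Ioo_subset_Icc_self hx.1)))
  rw [hsplit, integral_add (integrable_slab_dirDeriv (hcoeff .τ) .τ)
    (integrable_slab_dirDeriv (hcoeff .ρ) .ρ)]
  refine (congrArg₂ _ (integral_slab_dτ (hcoeff .τ) haT) (integral_slab_dρ (hcoeff .ρ) hP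
    (fun τ _ g => by simp [transportField]) fun τ hτ g => by rw [hP0 τ hτ g, mul_zero])).trans ?_
  simp only [transportField, add_zero]
  rw [integral_sub ((hslice (right_mem_Icc.2 haT)).const_mul _)
    ((hslice (left_mem_Icc.2 haT)).const_mul _), integral_const_mul, integral_const_mul]

end Slab

theorem continuousAt_of_ckAt_ofReal {k : ℕ} {A : Pt → ℝ} {x : Pt}
    (hA : CkAt k (fun y => (A y : ℂ)) x) : ContinuousAt A x := by
  simpa only [Function.comp_def, Complex.ofReal_re] using
    Complex.continuous_re.continuousAt.comp hA.continuousAt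

section Energy

variable {a T P : ℝ} {A B : Pt → ℝ}

theorem neg_mul_integral_slice_le_integral_slab_re_transport {σ : ℝ} (haT : a ≤ T) (hP : 0 ≤ P)
    (hσ : 0 ≤ 1 + σ * T) (hA : ∀ x : Pt, x.1 ∈ Icc a T → CkAt 1 (fun y => (A y : ℂ)) x)
    (hA0 : 0 ≤ A) (hAP : ∀ τ ∈ Icc a T, ∀ g, A (τ, P, g) = 0) :
    -((1 + σ * a) * ∫ y, A (a, y) ∂slice P) ≤
      ∫ x, (transport σ (fun y => (A y : ℂ)) x).re ∂slab a T P := by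
  have hre : ∫ x, (transport σ (fun y => (A y : ℂ)) x).re ∂slab a T P =
      (1 + σ * T) * ∫ y, A (T, y) ∂slice P - (1 + σ * a) * ∫ y, A (a, y) ∂slice P := by
    have hintegrable : Integrable (transport σ fun y => (A y : ℂ)) (slab a T P) :=
      integrable_slab fun x hx => CkAt.continuousAt (k := 0) ((hA x hx).transport σ)
    have hcomplex := integral_slab_transport hA σ haT hP fun τ hτ g => by
      rw [hAP τ hτ g, Complex.ofReal_zero]
    rw [integral_complex_ofReal, integral_complex_ofReal] at hcomplex
    refine (integral_re hintegrable).trans ?_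
    rw [hcomplex]
    norm_cast
  rw [hre]
  linarith [mul_nonneg hσ (integral_nonneg (μ := slice P) fun y => hA0 (T, y))]

theorem integral_slab_re_Xop {S : Field} (hS : ∀ x : Pt, x.1 ∈ Icc a T → CkAt 1 S x) (c : ℂ) :
    ∫ x, (Xop c S x).re ∂slab a T P = 0 := by
  have hintegrable : Integrable (Xop c S) (slab a T P) :=
    integrable_slab fun x hx => CkAt.continuousAt (k := 0) ((hS x hx).Xop c)
  exact (integral_re hintegrable).trans ((congrArg Complex.re (integral_slab_Xop hS c)).trans rfl)

section Inequality

variable {S : Field} (ha : -1 < a) (haT : a ≤ T) (hT : T < 1) (hP : 0 ≤ P)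
  (hA : ∀ x : Pt, x.1 ∈ Icc a T → CkAt 1 (fun y => (A y : ℂ)) x)
  (hB : ∀ x : Pt, x.1 ∈ Icc a T → CkAt 1 (fun y => (B y : ℂ)) x)
  (hS : ∀ x : Pt, x.1 ∈ Icc a T → CkAt 1 S x) (hA0 : 0 ≤ A) (hB0 : 0 ≤ B)
  (hAP : ∀ τ ∈ Icc a T, ∀ g, A (τ, P, g) = 0) (hBP : ∀ τ ∈ Icc a T, ∀ g, B (τ, P, g) = 0)
  (h : ∀ x : Pt, x.1 ∈ Ioo a T → x.2.1 ∈ Icc 0 P →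
    (transport 1 (fun y => (A y : ℂ)) x).re + (transport (-1) (fun y => (B y : ℂ)) x).re ≤
      -A x - B x + 2 * (Xop Complex.I S x).re)
include ha haT hT hP hA hB hS hA0 hB0 hAP hBP h

theorem integral_slab_le_of_transport_le :
    ∫ x, (A x + B x) ∂slab a T P ≤
      (1 + a) * ∫ y, A (a, y) ∂slice P + (1 - a) * ∫ y, B (a, y) ∂slice P := by
  have hre {f : Field} (hf : ∀ x : Pt, x.1 ∈ Icc a T → CkAt 0 f x) :
      Integrable (fun x => (f x).re) (slab a T P) :=
    integrable_slab fun x hx => Complex.continuous_re.continuousAt.comp (hf x hx).continuousAt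
  have htA := hre fun x hx => (hA x hx).transport 1
  have htB := hre fun x hx => (hB x hx).transport (-1)
  have hflux := hre fun x hx => (hS x hx).Xop Complex.I
  have hslab {E : Pt → ℝ} (hE : ∀ x : Pt, x.1 ∈ Icc a T → CkAt 1 (fun y => (E y : ℂ)) x) :
      Integrable E (slab a T P) :=
    integrable_slab fun x hx => continuousAt_of_ckAt_ofReal (hE x hx)
  have hbound : ∫ x, (A x + B x) ∂slab a T P ≤
      ∫ x, (2 * (Xop Complex.I S x).re - ((transport 1 (fun y => (A y : ℂ)) x).re +
        (transport (-1) (fun y => (B y : ℂ)) x).re)) ∂slab a T P := by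
    refine integral_mono_ae ((hslab hA).add (hslab hB)) ((hflux.const_mul 2).sub (htA.add htB)) ?_
    rw [slab_eq_restrict]
    refine (ae_restrict_iff' (measurableSet_Ioo.prod (measurableSet_Icc.prod .univ))).2
      (.of_forall fun x hx => ?_)
    dsimp only
    linarith [h x hx.1 hx.2.1]
  have hsplit := integral_sub (hflux.const_mul 2) (htA.add htB)
  simp only [Pi.add_apply] at hsplit
  rw [hsplit, integral_const_mul, integral_slab_re_Xop hS, integral_add htA htB] at hbound
  have hA' := neg_mul_integral_slice_le_integral_slab_re_transport (σ := 1) haT hP (by linarith)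
    hA hA0 hAP
  have hB' := neg_mul_integral_slice_le_integral_slab_re_transport (σ := -1) haT hP (by linarith)
    hB hB0 hBP
  linarith

theorem lintegral_slab_le_of_transport_le :
    ∫⁻ x, ENNReal.ofReal (A x + B x) ∂slab a T P ≤
      2 * ∫⁻ y, ENNReal.ofReal (A (a, y) + B (a, y)) ∂slice P := by
  have hslice {E : Pt → ℝ} (hE : ∀ x : Pt, x.1 ∈ Icc a T → CkAt 1 (fun y => (E y : ℂ)) x) :
      Integrable (fun y => E (a, y)) (slice P) :=
    integrable_slice (continuous_section fun y =>
      continuousAt_of_ckAt_ofReal (hE (a, y) (left_mem_Icc.2 haT)))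
  have hintegrable : Integrable (fun x => A x + B x) (slab a T P) := integrable_slab fun x hx =>
    (continuousAt_of_ckAt_ofReal (hA x hx)).add (continuousAt_of_ckAt_ofReal (hB x hx))
  have hintSlice : Integrable (fun y => A (a, y) + B (a, y)) (slice P) :=
    (hslice hA).add (hslice hB)
  have hAB0 (x : Pt) : 0 ≤ A x + B x := add_nonneg (hA0 x) (hB0 x)
  rw [← ofReal_integral_eq_lintegral_ofReal hintegrable (.of_forall hAB0),
    ← ofReal_integral_eq_lintegral_ofReal hintSlice (.of_forall fun _ => hAB0 _),
    ← ENNReal.ofReal_ofNat 2, ← ENNReal.ofReal_mul zero_le_two]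
  refine ENNReal.ofReal_le_ofReal
    ((integral_slab_le_of_transport_le ha haT hT hP hA hB hS hA0 hB0 hAP hBP h).trans ?_)
  rw [integral_add (hslice hA) (hslice hB), mul_add]
  exact add_le_add
    (mul_le_mul_of_nonneg_right (by linarith) (integral_nonneg fun y => hA0 (a, y)))
    (mul_le_mul_of_nonneg_right (by linarith) (integral_nonneg fun y => hB0 (a, y)))

end Inequality

end Energy

theorem transport_ofReal {F : Pt → ℝ} {x : Pt} {Fτ Fρ : ℝ} (σ : ℝ)
    (hτ : HasDerivAt (fun s => F (s, x.2)) Fτ x.1)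
    (hρ : HasDerivAt (fun s => F (x.1, s, x.2.2)) Fρ x.2.1) :
    transport σ (fun y => (F y : ℂ)) x = ((1 + σ * x.1) * Fτ - σ * x.2.1 * Fρ : ℝ) := by
  have hdτ : dτ (fun y => (F y : ℂ)) x = Fτ := hτ.ofReal_comp.deriv
  have hdρ : dρ (fun y => (F y : ℂ)) x = Fρ := hρ.ofReal_comp.deriv
  rw [transport_apply, hdτ, hdρ]
  push_cast
  ring

theorem transport_mul {f g : Field} {x : Pt} (σ : ℝ) (hf : CkAt 1 f x) (hg : CkAt 1 g x) :
    transport σ (fun y => f y * g y) x = transport σ f x * g x + f x * transport σ g x :=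
  vecDeriv_mul _ hf hg

theorem CkAt.ofReal_comp {k : ℕ} {F : ℝ × ℝ → ℝ} {x : Pt} (hF : ContDiff ℝ k F) :
    CkAt k (fun y => (F (y.1, y.2.1) : ℂ)) x :=
  CkAt.of_contDiff (F := fun y => (F y : ℂ)) (Complex.ofRealCLM.contDiff.comp hF)

section Weight

variable {l a c δ : ℝ} {x : Pt} {k : ℕ}

/-- The exponential weight that absorbs the zeroth order terms of the energy inequality. -/
def expWeight (l a : ℝ) (x : Pt) : ℝ := Real.exp (-(l * (x.1 - a)))

/-- The cutoff near the outer boundary `ρ (1 + τ) = c`. -/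
def outerCutoff (c δ : ℝ) (x : Pt) : ℝ :=
  Real.smoothTransition ((c - x.2.1 * (1 + x.1)) / δ - 1)

/-- The cutoff near the boundary `ρ = 0` and near `τ = 1`, where the fields need not be regular. -/
def innerCutoff (δ : ℝ) (x : Pt) : ℝ := Real.smoothTransition (x.2.1 * (1 - x.1) / δ - 1)

/-- The weight of the energy estimate. The functions `ρ (1 + τ)` and `ρ (1 - τ)` in its cutoffs are
constant along `transport 1` and `transport (-1)` respectively. -/
def weight (l a c δ : ℝ) (x : Pt) : ℝ := expWeight l a x * (outerCutoff c δ x * innerCutoff δ x)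

theorem ckAt_expWeight : CkAt k (fun y => (expWeight l a y : ℂ)) x :=
  CkAt.ofReal_comp (F := fun y => Real.exp (-(l * (y.1 - a)))) (by fun_prop)

theorem ckAt_outerCutoff : CkAt k (fun y => (outerCutoff c δ y : ℂ)) x :=
  CkAt.ofReal_comp (F := fun y => Real.smoothTransition ((c - y.2 * (1 + y.1)) / δ - 1))
    (Real.smoothTransition.contDiff.comp (by fun_prop))

theorem ckAt_innerCutoff : CkAt k (fun y => (innerCutoff δ y : ℂ)) x :=
  CkAt.ofReal_comp (F := fun y => Real.smoothTransition (y.2 * (1 - y.1) / δ - 1))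
    (Real.smoothTransition.contDiff.comp (by fun_prop))

theorem ckAt_weight : CkAt k (fun y => (weight l a c δ y : ℂ)) x := by
  simp only [weight, Complex.ofReal_mul]
  exact ckAt_expWeight.mul (ckAt_outerCutoff.mul ckAt_innerCutoff)

theorem weight_nonneg (l a c δ : ℝ) (x : Pt) : 0 ≤ weight l a c δ x :=
  mul_nonneg (Real.exp_pos _).le
    (mul_nonneg (Real.smoothTransition.nonneg _) (Real.smoothTransition.nonneg _))

theorem weight_le_one (hl : 0 ≤ l) (hx : a ≤ x.1) : weight l a c δ x ≤ 1 := by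
  have hexp : expWeight l a x ≤ 1 :=
    Real.exp_le_one_iff.2 (neg_nonpos.2 (mul_nonneg hl (sub_nonneg.2 hx)))
  exact mul_le_one₀ hexp
    (mul_nonneg (Real.smoothTransition.nonneg _) (Real.smoothTransition.nonneg _))
    (mul_le_one₀ (Real.smoothTransition.le_one _) (Real.smoothTransition.nonneg _)
      (Real.smoothTransition.le_one _))

theorem weight_eq_zero (hδ : 0 < δ) (hx : c - δ ≤ x.2.1 * (1 + x.1) ∨ x.2.1 * (1 - x.1) ≤ δ) :
    weight l a c δ x = 0 := by
  rcases hx with hx | hx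
  · have hcut : outerCutoff c δ x = 0 :=
      Real.smoothTransition.zero_of_nonpos (by rw [sub_nonpos, div_le_one hδ]; linarith)
    rw [weight, hcut, zero_mul, mul_zero]
  · have hcut : innerCutoff δ x = 0 :=
      Real.smoothTransition.zero_of_nonpos (by rw [sub_nonpos, div_le_one hδ]; linarith)
    rw [weight, hcut, mul_zero, mul_zero]

theorem weight_eq_expWeight (hδ : 0 < δ) (hout : x.2.1 * (1 + x.1) ≤ c - 2 * δ)
    (hin : 2 * δ ≤ x.2.1 * (1 - x.1)) : weight l a c δ x = expWeight l a x := by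
  have hout : outerCutoff c δ x = 1 :=
    Real.smoothTransition.one_of_one_le (by rw [le_sub_iff_add_le, le_div_iff₀ hδ]; linarith)
  have hin : innerCutoff δ x = 1 :=
    Real.smoothTransition.one_of_one_le (by rw [le_sub_iff_add_le, le_div_iff₀ hδ]; linarith)
  rw [weight, hout, hin, mul_one, mul_one]

theorem hasDerivAt_smoothTransition (s : ℝ) :
    HasDerivAt Real.smoothTransition (deriv Real.smoothTransition s) s :=
  ((Real.smoothTransition.contDiff (n := 1)).differentiable one_ne_zero s).hasDerivAt

theorem transport_expWeight (σ l a : ℝ) (x : Pt) :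
    transport σ (fun y => (expWeight l a y : ℂ)) x =
      (-(l * (1 + σ * x.1) * expWeight l a x) : ℝ) := by
  have hτ : HasDerivAt (fun s => expWeight l a (s, x.2))
      (Real.exp (-(l * (x.1 - a))) * -(l * 1)) x.1 :=
    (((hasDerivAt_id x.1).sub_const a).const_mul l).neg.exp
  have hρ : HasDerivAt (fun s => expWeight l a (x.1, s, x.2.2)) 0 x.2.1 := by
    simpa only [expWeight] using hasDerivAt_const x.2.1 (expWeight l a x)
  rw [transport_ofReal σ hτ hρ, expWeight]
  congr 1
  ring

theorem re_transport_outerCutoff_nonpos {σ : ℝ} (hσ : σ ≤ 1) (hδ : 0 < δ) (hρ : 0 ≤ x.2.1) :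
    (transport σ (fun y => (outerCutoff c δ y : ℂ)) x).re ≤ 0 := by
  have hτ := (hasDerivAt_smoothTransition _).comp x.1
    ((((((hasDerivAt_id x.1).const_add 1).const_mul x.2.1).const_sub c).div_const δ).sub_const 1)
  have hρ' := (hasDerivAt_smoothTransition _).comp x.2.1
    (((((hasDerivAt_id x.2.1).mul_const (1 + x.1)).const_sub c).div_const δ).sub_const 1)
  rw [transport_ofReal (F := outerCutoff c δ) σ hτ hρ', Complex.ofReal_re]
  have hnonneg := mul_nonneg (mul_nonneg (div_nonneg hρ hδ.le) (sub_nonneg.2 hσ))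
    (Real.smoothTransition.monotone.deriv_nonneg (x := (c - x.2.1 * (1 + x.1)) / δ - 1))
  refine (neg_nonpos.2 hnonneg).trans_eq' ?_
  simp only [id]
  ring

theorem re_transport_innerCutoff_nonpos {σ : ℝ} (hσ : -1 ≤ σ) (hδ : 0 < δ) (hρ : 0 ≤ x.2.1) :
    (transport σ (fun y => (innerCutoff δ y : ℂ)) x).re ≤ 0 := by
  have hτ := (hasDerivAt_smoothTransition _).comp x.1
    (((((hasDerivAt_id x.1).const_sub 1).const_mul x.2.1).div_const δ).sub_const 1)
  have hρ' := (hasDerivAt_smoothTransition _).comp x.2.1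
    ((((hasDerivAt_id x.2.1).mul_const (1 - x.1)).div_const δ).sub_const 1)
  rw [transport_ofReal (F := innerCutoff δ) σ hτ hρ', Complex.ofReal_re]
  have hnonneg := mul_nonneg (mul_nonneg (div_nonneg hρ hδ.le) (neg_le_iff_add_nonneg'.1 hσ))
    (Real.smoothTransition.monotone.deriv_nonneg (x := x.2.1 * (1 - x.1) / δ - 1))
  refine (neg_nonpos.2 hnonneg).trans_eq' ?_
  simp only [id]
  ring

theorem re_transport_weight_le {σ : ℝ} (hσ : σ ∈ Icc (-1) 1) (hδ : 0 < δ) (hρ : 0 ≤ x.2.1) :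
    (transport σ (fun y => (weight l a c δ y : ℂ)) x).re ≤
      -(l * (1 + σ * x.1) * weight l a c δ x) := by
  have hmul : (transport σ (fun y => (weight l a c δ y : ℂ)) x).re =
      -(l * (1 + σ * x.1) * weight l a c δ x) + expWeight l a x *
        ((transport σ (fun y => (outerCutoff c δ y : ℂ)) x).re * innerCutoff δ x +
          outerCutoff c δ x * (transport σ (fun y => (innerCutoff δ y : ℂ)) x).re) := by
    simp only [weight, Complex.ofReal_mul]
    rw [transport_mul σ ckAt_expWeight (ckAt_outerCutoff.mul ckAt_innerCutoff),
      transport_mul σ ckAt_outerCutoff ckAt_innerCutoff, transport_expWeight]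
    simp only [Complex.ofReal_neg, Complex.ofReal_mul, Complex.ofReal_add, Complex.ofReal_one,
      Complex.add_re, Complex.neg_re, Complex.mul_re, Complex.ofReal_re, Complex.one_re,
      Complex.ofReal_im, Complex.add_im, Complex.one_im, Complex.mul_im]
    ring
  have hout := mul_nonpos_of_nonpos_of_nonneg
    (re_transport_outerCutoff_nonpos (c := c) hσ.2 hδ hρ)
    (Real.smoothTransition.nonneg (x.2.1 * (1 - x.1) / δ - 1))
  have hin := mul_nonpos_of_nonneg_of_nonpos
    (Real.smoothTransition.nonneg ((c - x.2.1 * (1 + x.1)) / δ - 1))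
    (re_transport_innerCutoff_nonpos hσ.1 hδ hρ)
  rw [hmul]
  exact add_le_of_nonpos_right
    (mul_nonpos_of_nonneg_of_nonpos (Real.exp_pos _).le (add_nonpos hout hin))

theorem re_transport_weight_mul {A : Pt → ℝ} (σ : ℝ) (hA : CkAt 1 (fun y => (A y : ℂ)) x) :
    (transport σ (fun y => ((weight l a c δ y * A y : ℝ) : ℂ)) x).re =
      (transport σ (fun y => (weight l a c δ y : ℂ)) x).re * A x +
        weight l a c δ x * (transport σ (fun y => (A y : ℂ)) x).re := by
  simp only [Complex.ofReal_mul]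
  rw [transport_mul σ ckAt_weight hA, Complex.add_re, Complex.re_mul_ofReal, Complex.re_ofReal_mul]

theorem Xop_weight_mul {S : Field} (b : ℂ) (hS : CkAt 1 S x) :
    Xop b (fun y => weight l a c δ y * S y) x = weight l a c δ x * Xop b S x := by
  have hweight : Xop b (fun y => (weight l a c δ y : ℂ)) x = 0 := by
    simp [Xop_apply, Z, weight, expWeight, outerCutoff, innerCutoff]
  rw [Xop, vecDeriv_mul _ ckAt_weight hS, ← Xop, hweight, zero_mul, zero_add]

end Weight

section Bulk

variable {C a t c δ l : ℝ} {A B : Pt → ℝ} {S f : Field} {x : Pt}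

/-- The part of the domain `N_t` where `ρ > 0`, before its final time and off its outer boundary
`ρ (1 + τ) = c`. The fields of the hierarchy are regular and satisfy their equations there. -/
def bulk (a t c : ℝ) : Set Pt := {x | x.1 ∈ Ico a t ∧ 0 < x.2.1 ∧ x.2.1 * (1 + x.1) < c}

/-- The part of `bulk a t c` on which the cutoffs in the weight with parameter `δ` are trivial. -/
def innerRegion (a t c δ : ℝ) : Set Pt :=
  {x | x.1 ∈ Ioo a (t - δ) ∧ x.2.1 * (1 + x.1) ≤ c - 2 * δ ∧ 2 * δ ≤ x.2.1 * (1 - x.1)}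

theorem measurableSet_bulk (a t c : ℝ) : MeasurableSet (bulk a t c) :=
  (measurable_fst measurableSet_Ico).inter
    ((measurableSet_lt measurable_const measurable_snd.fst).inter
      (measurableSet_lt (measurable_snd.fst.mul (measurable_fst.const_add 1)) measurable_const))

theorem measurableSet_innerRegion (a t c δ : ℝ) : MeasurableSet (innerRegion a t c δ) :=
  (measurable_fst measurableSet_Ioo).inter
    ((measurableSet_le (measurable_snd.fst.mul (measurable_fst.const_add 1))
      measurable_const).inter
      (measurableSet_le measurable_const (measurable_snd.fst.mul (measurable_fst.const_sub 1))))

theorem eventually_mem_bulk (hx : x ∈ bulk a t c) (ha : a < x.1) : ∀ᶠ y in 𝓝 x, y ∈ bulk a t c := by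
  have hτ : ContinuousAt (fun y : Pt => y.1) x := by fun_prop
  have hρ : ContinuousAt (fun y : Pt => y.2.1) x := by fun_prop
  have hout : ContinuousAt (fun y : Pt => y.2.1 * (1 + y.1)) x := by fun_prop
  filter_upwards [hτ.eventually (Ioo_mem_nhds ha hx.1.2), hρ.eventually (Ioi_mem_nhds hx.2.1),
    hout.eventually (Iio_mem_nhds hx.2.2)] with y hyτ hyρ hyout
  exact ⟨⟨hyτ.1.le, hyτ.2⟩, hyρ, hyout⟩

theorem monotone_innerRegion (a t c : ℝ) :
    Monotone fun k : ℕ => innerRegion a t c (1 / ((k : ℝ) + 1)) := by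
  rintro k k' hk x ⟨hτ, hout, hin⟩
  have hδ : 1 / ((k' : ℝ) + 1) ≤ 1 / ((k : ℝ) + 1) := Nat.one_div_le_one_div hk
  exact ⟨⟨hτ.1, by linarith [hτ.2]⟩, by linarith, by linarith⟩

theorem bulk_ae_le_iUnion_innerRegion (ht : t ≤ 1) :
    bulk a t c ≤ᵐ[dv] ⋃ k : ℕ, innerRegion a t c (1 / ((k : ℝ) + 1)) := by
  have hne : ∀ᵐ x : Pt ∂dv, x.1 ≠ a :=
    Measure.quasiMeasurePreserving_fst.ae (Measure.ae_ne volume a)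
  filter_upwards [hne] with x hxa hx
  obtain ⟨hτ, hρ, hout⟩ : x ∈ bulk a t c := hx
  have hin : 0 < x.2.1 * (1 - x.1) := mul_pos hρ (by linarith [hτ.2])
  obtain ⟨k, hk⟩ := exists_nat_one_div_lt
    (lt_min (sub_pos.2 hτ.2) (lt_min (half_pos (sub_pos.2 hout)) (half_pos hin)))
  simp only [lt_min_iff] at hk
  exact mem_iUnion.2
    ⟨k, ⟨lt_of_le_of_ne hτ.1 hxa.symm, by linarith⟩, by linarith, by linarith⟩

theorem eventually_weight_eq_zero (l a : ℝ) (hδ : 0 < δ) (hτ : x.1 ∈ Ico a t) (ht : t ≤ 1)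
    (hx : x ∉ bulk a t c) : ∀ᶠ y in 𝓝 x, weight l a c δ y = 0 := by
  by_cases hρ : 0 < x.2.1
  · have hout : c - δ < x.2.1 * (1 + x.1) := by
      have : c ≤ x.2.1 * (1 + x.1) := not_lt.1 fun h => hx ⟨hτ, hρ, h⟩
      linarith
    have hcont : ContinuousAt (fun y : Pt => y.2.1 * (1 + y.1)) x := by fun_prop
    filter_upwards [hcont.eventually (Ioi_mem_nhds hout)] with y hy
    exact weight_eq_zero hδ (.inl (le_of_lt hy))
  · have hin : x.2.1 * (1 - x.1) < δ :=
      (mul_nonpos_of_nonpos_of_nonneg (not_lt.1 hρ) (by linarith [hτ.2])).trans_lt hδ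
    have hcont : ContinuousAt (fun y : Pt => y.2.1 * (1 - y.1)) x := by fun_prop
    filter_upwards [hcont.eventually (Iio_mem_nhds hin)] with y hy
    exact weight_eq_zero hδ (.inr (le_of_lt hy))

theorem ckAt_weight_mul (l : ℝ) (hδ : 0 < δ) (ht : t ≤ 1) (hf : ∀ y ∈ bulk a t c, CkAt 1 f y)
    (hτ : x.1 ∈ Icc a (t - δ)) : CkAt 1 (fun y => weight l a c δ y * f y) x := by
  by_cases hx : x ∈ bulk a t c
  · exact ckAt_weight.mul (hf x hx)
  · refine (CkAt.const 0).congr ?_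
    filter_upwards [eventually_weight_eq_zero l a hδ ⟨hτ.1, by linarith [hτ.2]⟩ ht hx] with y hy
    rw [hy, Complex.ofReal_zero, zero_mul]

/-- The energy inequality on `bulk a t c` for nonnegative fields `A`, `B` with flux `S`. A solution
`u`, `v` of a pair of transport equations provides one, `A` and `B` being the energies of `u` and
`v` and `S` their cross term. -/
structure EnergyInequality (C a t c : ℝ) (A B : Pt → ℝ) (S : Field) : Prop where
  ckAt_left : ∀ x ∈ bulk a t c, CkAt 1 (fun y => (A y : ℂ)) x
  ckAt_right : ∀ x ∈ bulk a t c, CkAt 1 (fun y => (B y : ℂ)) x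
  ckAt_flux : ∀ x ∈ bulk a t c, CkAt 1 S x
  left_nonneg : 0 ≤ A
  right_nonneg : 0 ≤ B
  transport_le : ∀ x ∈ bulk a t c, a < x.1 →
    (transport 1 (fun y => (A y : ℂ)) x).re + (transport (-1) (fun y => (B y : ℂ)) x).re ≤
      C * A x - B x + 2 * (Xop Complex.I S x).re

theorem transport_weight_mul_le (h : EnergyInequality C a t c A B S) (ha : -1 < a) (hC : 0 ≤ C)
    (ht : t ≤ 1) (hδ : 0 < δ) (hl : l = (C + 1) / (1 + a)) (hx : x.1 ∈ Ioo a (t - δ))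
    (hρ : 0 ≤ x.2.1) :
    (transport 1 (fun y => ((weight l a c δ y * A y : ℝ) : ℂ)) x).re +
        (transport (-1) (fun y => ((weight l a c δ y * B y : ℝ) : ℂ)) x).re ≤
      -(weight l a c δ x * A x) - weight l a c δ x * B x +
        2 * (Xop Complex.I (fun y => weight l a c δ y * S y) x).re := by
  have ha' : 0 < 1 + a := by linarith
  have hl0 : 0 ≤ l := hl ▸ by positivity
  by_cases hbulk : x ∈ bulk a t c
  · rw [re_transport_weight_mul 1 (h.ckAt_left x hbulk),
      re_transport_weight_mul (-1) (h.ckAt_right x hbulk),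
      Xop_weight_mul _ (h.ckAt_flux x hbulk), Complex.re_ofReal_mul]
    have hw := weight_nonneg l a c δ x
    have hgrowth : C + 1 ≤ l * (1 + x.1) := by
      rw [hl, div_mul_eq_mul_div, le_div_iff₀ ha']
      exact mul_le_mul_of_nonneg_left (by linarith [hx.1]) (by positivity)
    have hleft := mul_le_mul_of_nonneg_right
      (re_transport_weight_le (l := l) (a := a) (c := c) (σ := 1) (by simp) hδ hρ)
      (h.left_nonneg x)
    have hright := mul_le_mul_of_nonneg_right
      (re_transport_weight_le (l := l) (a := a) (c := c) (σ := -1) (by simp) hδ hρ)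
      (h.right_nonneg x)
    have habsorbA := mul_le_mul_of_nonneg_right hgrowth (mul_nonneg hw (h.left_nonneg x))
    have habsorbB := mul_nonneg (mul_nonneg hl0 (by linarith [hx.2] : 0 ≤ 1 - x.1))
      (mul_nonneg hw (h.right_nonneg x))
    have hweighted := mul_le_mul_of_nonneg_left (h.transport_le x hbulk hx.1) hw
    linarith
  · have hzero := eventually_weight_eq_zero l a hδ ⟨hx.1.le, by linarith [hx.2]⟩ ht hbulk
    have hfield {E : Pt → ℂ} : (fun y => (weight l a c δ y : ℂ) * E y) =ᶠ[𝓝 x] fun _ => 0 := by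
      filter_upwards [hzero] with y hy
      rw [hy, Complex.ofReal_zero, zero_mul]
    simp only [Complex.ofReal_mul, transport, Xop]
    rw [vecDeriv_congr _ hfield, vecDeriv_congr _ hfield, vecDeriv_congr _ hfield,
      hzero.self_of_nhds]
    simp [vecDeriv, dirDeriv_const]

theorem lintegral_slab_weight_mul_le (h : EnergyInequality C a t c A B S) (ha : -1 < a)
    (hC : 0 ≤ C) (ht : t ≤ 1) (hc : 0 < c) (hδ : 0 < δ) (hδt : a ≤ t - δ)
    (hl : l = (C + 1) / (1 + a)) :
    ∫⁻ x, ENNReal.ofReal (weight l a c δ x * A x + weight l a c δ x * B x)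
        ∂slab a (t - δ) (c / (1 + a)) ≤
      2 * ∫⁻ y, ENNReal.ofReal (A (a, y) + B (a, y)) ∂slice (c / (1 + a)) := by
  have ha' : 0 < 1 + a := by linarith
  have hl0 : 0 ≤ l := hl ▸ by positivity
  have hregular {E : Pt → ℝ} (hE : ∀ x ∈ bulk a t c, CkAt 1 (fun y => (E y : ℂ)) x) (x : Pt)
      (hx : x.1 ∈ Icc a (t - δ)) : CkAt 1 (fun y => ((weight l a c δ y * E y : ℝ) : ℂ)) x := by
    simpa only [Complex.ofReal_mul] using ckAt_weight_mul l hδ ht hE hx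
  have hboundary (E : Pt → ℝ) (τ : ℝ) (hτ : τ ∈ Icc a (t - δ)) (g : SU2) :
      weight l a c δ (τ, c / (1 + a), g) * E (τ, c / (1 + a), g) = 0 := by
    rw [weight_eq_zero hδ (.inl ?_), zero_mul]
    have hc' : c ≤ c / (1 + a) * (1 + τ) := by
      rw [div_mul_eq_mul_div, le_div_iff₀ ha']
      exact mul_le_mul_of_nonneg_left (by linarith [hτ.1]) hc.le
    exact (sub_le_self c hδ.le).trans hc'
  refine (lintegral_slab_le_of_transport_le ha hδt (by linarith) (by positivity)
    (hregular h.ckAt_left) (hregular h.ckAt_right)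
    (fun x hx => ckAt_weight_mul l hδ ht h.ckAt_flux hx)
    (fun x => mul_nonneg (weight_nonneg l a c δ x) (h.left_nonneg x))
    (fun x => mul_nonneg (weight_nonneg l a c δ x) (h.right_nonneg x))
    (hboundary A) (hboundary B)
    fun x hx hρ => transport_weight_mul_le h ha hC ht hδ hl hx hρ.1).trans ?_
  gcongr with y
  · exact mul_le_of_le_one_left (h.left_nonneg _) (weight_le_one hl0 le_rfl)
  · exact mul_le_of_le_one_left (h.right_nonneg _) (weight_le_one hl0 le_rfl)

theorem one_le_exp_mul_weight (hl : 0 ≤ l) (ha : -1 < a) (ht : t ≤ 1) (hδ : 0 < δ)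
    (hx : x ∈ innerRegion a t c δ) : 1 ≤ Real.exp (2 * l) * weight l a c δ x := by
  obtain ⟨hτ, hout, hin⟩ := hx
  rw [weight_eq_expWeight hδ hout hin, expWeight, ← Real.exp_add]
  refine Real.one_le_exp ?_
  have : l * (x.1 - a) ≤ l * 2 := mul_le_mul_of_nonneg_left (by linarith [hτ.2]) hl
  linarith

theorem innerRegion_subset (ha : -1 < a) (ht : t ≤ 1) (hδ : 0 < δ) :
    innerRegion a t c δ ⊆ Ioo a (t - δ) ×ˢ Icc 0 (c / (1 + a)) ×ˢ univ := by
  rintro x ⟨hτ, hout, hin⟩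
  have hρ : 0 < x.2.1 :=
    pos_of_mul_pos_left (lt_of_lt_of_le (by linarith) hin) (by linarith [hτ.2])
  refine ⟨hτ, ⟨hρ.le, ?_⟩, mem_univ _⟩
  rw [le_div_iff₀ (by linarith)]
  linarith [mul_le_mul_of_nonneg_left hτ.1.le hρ.le]

theorem lintegral_innerRegion_le (h : EnergyInequality C a t c A B S) (ha : -1 < a) (hC : 0 ≤ C)
    (ht : t ≤ 1) (hc : 0 < c) (hδ : 0 < δ) (hl : l = (C + 1) / (1 + a)) :
    ∫⁻ x in innerRegion a t c δ, ENNReal.ofReal (A x + B x) ∂dv ≤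
      ENNReal.ofReal (Real.exp (2 * l)) *
        (2 * ∫⁻ y, ENNReal.ofReal (A (a, y) + B (a, y)) ∂slice (c / (1 + a))) := by
  rcases lt_or_ge (t - δ) a with hempty | hδt
  · rw [show innerRegion a t c δ = ∅ from
      eq_empty_of_forall_notMem fun x hx => (hx.1.1.trans hx.1.2).not_gt hempty]
    simp
  have ha' : 0 < 1 + a := by linarith
  have hl0 : 0 ≤ l := hl ▸ by positivity
  calc ∫⁻ x in innerRegion a t c δ, ENNReal.ofReal (A x + B x) ∂dv
      ≤ ∫⁻ x in innerRegion a t c δ, ENNReal.ofReal (Real.exp (2 * l)) *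
          ENNReal.ofReal (weight l a c δ x * A x + weight l a c δ x * B x) ∂dv := by
        refine setLIntegral_mono' (measurableSet_innerRegion a t c δ) fun x hx => ?_
        rw [← ENNReal.ofReal_mul (Real.exp_pos _).le, ← mul_add, ← mul_assoc]
        exact ENNReal.ofReal_le_ofReal (le_mul_of_one_le_left
          (add_nonneg (h.left_nonneg x) (h.right_nonneg x))
          (one_le_exp_mul_weight hl0 ha ht hδ hx))
    _ = ENNReal.ofReal (Real.exp (2 * l)) * ∫⁻ x in innerRegion a t c δ,
          ENNReal.ofReal (weight l a c δ x * A x + weight l a c δ x * B x) ∂dv :=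
        lintegral_const_mul' _ _ ENNReal.ofReal_ne_top
    _ ≤ ENNReal.ofReal (Real.exp (2 * l)) *
          ∫⁻ x, ENNReal.ofReal (weight l a c δ x * A x + weight l a c δ x * B x)
            ∂slab a (t - δ) (c / (1 + a)) := by
        rw [slab_eq_restrict]
        gcongr
        exact innerRegion_subset ha ht hδ
    _ ≤ _ := by
        gcongr
        exact lintegral_slab_weight_mul_le h ha hC ht hc hδ hδt hl

theorem lintegral_bulk_le (h : EnergyInequality C a t c A B S) (ha : -1 < a) (hC : 0 ≤ C)
    (ht : t ≤ 1) (hc : 0 < c) :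
    ∫⁻ x in bulk a t c, ENNReal.ofReal (A x + B x) ∂dv ≤
      ENNReal.ofReal (Real.exp (2 * ((C + 1) / (1 + a)))) *
        (2 * ∫⁻ y, ENNReal.ofReal (A (a, y) + B (a, y)) ∂slice (c / (1 + a))) := by
  refine (lintegral_mono_set' (bulk_ae_le_iUnion_innerRegion ht)).trans ?_
  rw [setLIntegral_iUnion_of_directed _ (monotone_innerRegion a t c).directed_le]
  exact iSup_le fun k => lintegral_innerRegion_le h ha hC ht hc Nat.one_div_pos_of_nat rfl

end Bulk

section Parallelogram

variable {p m : ℕ} {f g : Field} {x : Pt} {ν : Measure Pt}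

theorem two_mul_energy_add_energy_sub (hf : CkAt (p + m) f x) (hg : CkAt (p + m) g x) :
    2 * energy p m (fun y => f y + 1 / 2 * g y) x +
        2 * energy p m (fun y => f y + -(1 / 2) * g y) x =
      4 * energy p m f x + energy p m g x := by
  simp only [energy, Finset.mul_sum, ← Finset.sum_add_distrib]
  refine Finset.sum_congr rfl fun n hn => ?_
  have hlen := length_mixedWord_le (p := p) hn
  have hadd (s : ℂ) : wordDeriv (mixedWord p n) (fun y => f y + s * g y) x =
      wordDeriv (mixedWord p n) f x + s * wordDeriv (mixedWord p n) g x := by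
    rw [wordDeriv_add (hf.mono hlen) ((hg.mono hlen).const_mul s),
      wordDeriv_const_mul s (hg.mono hlen)]
  have hparallelogram := parallelogram_law_with_norm ℝ (wordDeriv (mixedWord p n) f x)
    (1 / 2 * wordDeriv (mixedWord p n) g x)
  rw [hadd, hadd, neg_mul, ← sub_eq_add_neg]
  rw [norm_mul, show ‖(1 / 2 : ℂ)‖ = 1 / 2 by norm_num] at hparallelogram
  linarith

theorem aemeasurable_density (hf : ∀ᵐ x ∂ν, CkAt (p + m) f x) :
    AEMeasurable (density m (dρ^[p] f)) ν := by
  have hopen : IsOpen {x | CkAt (p + m) f x} := isOpen_iff_mem_nhds.2 fun x hx => hx.eventually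
  have hcont : ContinuousOn (energy p m f) {x | CkAt (p + m) f x} := fun x hx =>
    (continuousAt_of_ckAt_ofReal (CkAt.energy (k := 0) hx)).continuousWithinAt
  rw [funext (density_iterate_dρ p m f), ← Measure.restrict_eq_self_of_ae_mem hf]
  exact (hcont.aemeasurable hopen.measurableSet).ennreal_ofReal

theorem two_mul_lintegral_density_add_density_sub (hf : ∀ᵐ x ∂ν, CkAt (p + m) f x)
    (hg : ∀ᵐ x ∂ν, CkAt (p + m) g x) :
    2 * ∫⁻ x, density m (dρ^[p] fun y => f y + 1 / 2 * g y) x ∂ν +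
        2 * ∫⁻ x, density m (dρ^[p] fun y => f y + -(1 / 2) * g y) x ∂ν =
      4 * ∫⁻ x, density m (dρ^[p] f) x ∂ν + ∫⁻ x, density m (dρ^[p] g) x ∂ν := by
  have hmeas (s : ℂ) : AEMeasurable (density m (dρ^[p] fun y => f y + s * g y)) ν :=
    aemeasurable_density (hf.mp (hg.mono fun x hg hf => hf.add (hg.const_mul s)))
  have hmeas' := aemeasurable_density hf
  rw [← lintegral_const_mul'' _ (hmeas _), ← lintegral_const_mul'' _ (hmeas _),
    ← lintegral_const_mul'' _ hmeas', ← lintegral_add_left' ((hmeas _).const_mul _),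
    ← lintegral_add_left' (hmeas'.const_mul _)]
  refine lintegral_congr_ae ?_
  filter_upwards [hf, hg] with x hf hg
  have hpoint := two_mul_energy_add_energy_sub hf hg
  simp only [density_iterate_dρ, ← ENNReal.ofReal_ofNat, ← ENNReal.ofReal_mul zero_le_two,
    ← ENNReal.ofReal_mul zero_le_four]
  rw [← ENNReal.ofReal_add, ← ENNReal.ofReal_add, hpoint] <;>
    simp [energy_nonneg]

end Parallelogram

section Hierarchy

variable {f g : Field} {x : Pt}

theorem transport_add_const_mul (σ : ℝ) (s : ℂ) (hf : CkAt 1 f x) (hg : CkAt 1 g x) :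
    transport σ (fun y => f y + s * g y) x = transport σ f x + s * transport σ g x :=
  vecDeriv_add_const_mul _ s hf hg

theorem Xop_add_const_mul (c s : ℂ) (hf : CkAt 1 f x) (hg : CkAt 1 g x) :
    Xop c (fun y => f y + s * g y) x = Xop c f x + s * Xop c g x :=
  vecDeriv_add_const_mul _ s hf hg

variable {ψ : Field} {ψk : Fin 3 → Field}

theorem TransportAt.transportPairAt_two_add (h : TransportAt ψ ψk x) (h₁ : CkAt 1 (ψk 1) x)
    (hψ : CkAt 1 ψ x) : TransportPairAt 0 1 (ψk 2) (fun y => ψk 1 y + 1 / 2 * ψ y) x where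
  fst := by
    have hA0 := h.A0
    rw [Xop_add_const_mul _ _ h₁ hψ, ← Xminus_eq_Xop, ← Xminus_eq_Xop, transport_apply]
    push_cast
    linear_combination hA0
  snd := by
    have hB0 := h.B0
    rw [transport_add_const_mul _ _ h₁ hψ, ← Xplus_eq_Xop, transport_apply, transport_apply]
    push_cast
    linear_combination hB0

theorem TransportAt.transportPairAt_sub_zero (h : TransportAt ψ ψk x) (h₁ : CkAt 1 (ψk 1) x)
    (hψ : CkAt 1 ψ x) :
    TransportPairAt (-1) 0 (fun y => ψk 1 y + -(1 / 2) * ψ y) (ψk 0) x where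
  fst := by
    have hA1 := h.A1
    rw [transport_add_const_mul _ _ h₁ hψ, ← Xminus_eq_Xop, transport_apply, transport_apply]
    push_cast
    linear_combination hA1
  snd := by
    have hB1 := h.B1
    rw [Xop_add_const_mul _ _ h₁ hψ, ← Xplus_eq_Xop, ← Xplus_eq_Xop, transport_apply]
    push_cast
    linear_combination hB1

end Hierarchy

section Estimate

variable {p m : ℕ} {a t c ε ρs : ℝ}

/-- The measure `dρ dμ` on the slice `{a} × [0, P] × SU(2)`. -/
def initialSlice (a P : ℝ) : Measure Pt := (slice P).map (Prod.mk a)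

theorem lintegral_initialSlice (a P : ℝ) (F : Pt → ℝ≥0∞) :
    ∫⁻ x, F x ∂initialSlice a P = ∫⁻ y, F (a, y) ∂slice P :=
  (measurableEmbedding_prodMk_left a).lintegral_map F

theorem ae_initialSlice_mem_bulk (ha : -1 < a) (hat : a < t) :
    ∀ᵐ x ∂initialSlice a (c / (1 + a)), x ∈ bulk a t c := by
  rw [initialSlice, (measurableEmbedding_prodMk_left a).ae_map_iff, slice_eq_restrict,
    ae_restrict_iff' (measurableSet_Icc.prod .univ)]
  have hne (r : ℝ) : ∀ᵐ y : ℝ × SU2 ∂(volume : Measure ℝ).prod haarSU2, y.1 ≠ r :=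
    Measure.quasiMeasurePreserving_fst.ae (Measure.ae_ne volume r)
  filter_upwards [hne 0, hne (c / (1 + a))] with y hy0 hyP hy
  have hlt : y.1 < c / (1 + a) := lt_of_le_of_ne hy.1.2 hyP
  exact ⟨⟨le_rfl, hat⟩, lt_of_le_of_ne hy.1.1 hy0.symm, (lt_div_iff₀ (by linarith)).1 hlt⟩

theorem TransportPairAt.energyInequality {C c₁ c₂ : ℝ} {u v : Field}
    (hC : ∀ {x}, CkAt (p + m + 1) u x → CkAt (p + m + 1) v x →
      (∀ᶠ y in 𝓝 x, TransportPairAt c₁ c₂ u v y) →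
      (transport 1 (fun y => (energy p m u y : ℂ)) x).re +
          (transport (-1) (fun y => (energy p m v y : ℂ)) x).re ≤
        C * energy p m u x - energy p m v x + 2 * (Xop Complex.I (cross p m u v) x).re)
    (hu : ∀ x ∈ bulk a t c, CkAt (p + m + 1) u x) (hv : ∀ x ∈ bulk a t c, CkAt (p + m + 1) v x)
    (h : ∀ x ∈ bulk a t c, TransportPairAt c₁ c₂ u v x) :
    EnergyInequality C a t c (energy p m u) (energy p m v) (cross p m u v) where
  ckAt_left x hx := (hu x hx).energy
  ckAt_right x hx := (hv x hx).energy
  ckAt_flux x hx := (hu x hx).cross (hv x hx)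
  left_nonneg := energy_nonneg p m u
  right_nonneg := energy_nonneg p m v
  transport_le x hx ha :=
    hC (hu x hx) (hv x hx) ((eventually_mem_bulk hx ha).mono fun y hy => h y hy)

theorem exists_lintegral_density_pair_le (hpm : m + 1 < p) (ha : -1 < a) : ∃ K : ℝ, 0 < K ∧
    ∀ {c₁ c₂ t c : ℝ}, c₁ ≤ 0 → c₂ ≤ 1 → a < t → t ≤ 1 → 0 < c → ∀ {u v : Field},
      (∀ x ∈ bulk a t c, CkAt (p + m + 1) u x) → (∀ x ∈ bulk a t c, CkAt (p + m + 1) v x) →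
      (∀ x ∈ bulk a t c, TransportPairAt c₁ c₂ u v x) →
      ∫⁻ x in bulk a t c, density m (dρ^[p] u) x ∂dv +
          ∫⁻ x in bulk a t c, density m (dρ^[p] v) x ∂dv ≤
        ENNReal.ofReal K * (∫⁻ x, density m (dρ^[p] u) x ∂initialSlice a (c / (1 + a)) +
          ∫⁻ x, density m (dρ^[p] v) x ∂initialSlice a (c / (1 + a))) := by
  obtain ⟨C, hC, hineq⟩ := exists_energy_inequality hpm
  refine ⟨Real.exp (2 * ((C + 1) / (1 + a))) * 2, by positivity, ?_⟩
  intro c₁ c₂ t c hc₁ hc₂ hat ht hc u v hu hv h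
  have hbound := lintegral_bulk_le
    (TransportPairAt.energyInequality (hineq hc₁ hc₂) hu hv h) ha hC ht hc
  have hmeas : AEMeasurable (density m (dρ^[p] u)) (initialSlice a (c / (1 + a))) :=
    aemeasurable_density
      ((ae_initialSlice_mem_bulk ha hat).mono fun x hx => (hu x hx).mono (Nat.le_succ _))
  simp only [ENNReal.ofReal_add (energy_nonneg p m u _) (energy_nonneg p m v _),
    ← density_iterate_dρ] at hbound
  rw [← lintegral_initialSlice a _ fun x => density m (dρ^[p] u) x + density m (dρ^[p] v) x,
    lintegral_add_left' hmeas, ← mul_assoc] at hbound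
  rw [ENNReal.ofReal_mul (Real.exp_pos _).le, ENNReal.ofReal_ofNat]
  exact (le_lintegral_add _ _).trans hbound

theorem sum_le_of_paired_le {K x₀ x₁ x₂ x xa xs y₀ y₁ y₂ y ya ys : ℝ≥0∞}
    (hfst : x₂ + xa ≤ K * (y₂ + ya)) (hsnd : xs + x₀ ≤ K * (ys + y₀))
    (hx : 2 * xa + 2 * xs = 4 * x₁ + x) (hy : 2 * ya + 2 * ys = 4 * y₁ + y) :
    x₀ + x₁ + x₂ + x ≤ K * 4 * (y₀ + y₁ + y₂ + y) :=
  calc x₀ + x₁ + x₂ + x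
      ≤ x₀ + x₁ + x₂ + x + (x₀ + 3 * x₁ + x₂) := le_self_add
    _ = 2 * x₀ + 2 * x₂ + (4 * x₁ + x) := by ring
    _ = 2 * ((x₂ + xa) + (xs + x₀)) := by rw [← hx]; ring
    _ ≤ 2 * (K * (y₂ + ya) + K * (ys + y₀)) := by gcongr
    _ = K * (2 * y₀ + 2 * y₂ + (2 * ya + 2 * ys)) := by ring
    _ = K * (2 * y₀ + 2 * y₂ + (4 * y₁ + y)) := by rw [hy]
    _ ≤ K * (2 * y₀ + 2 * y₂ + (4 * y₁ + y) + (2 * y₀ + 2 * y₂ + 3 * y)) :=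
        mul_le_mul' le_rfl le_self_add
    _ = K * 4 * (y₀ + y₁ + y₂ + y) := by ring

theorem exists_lintegral_density_hierarchy_le (hpm : m + 1 < p) (ha : -1 < a) : ∃ K : ℝ, 0 < K ∧
    ∀ {t c : ℝ}, a < t → t ≤ 1 → 0 < c → ∀ {ψ : Field} {ψk : Fin 3 → Field},
      (∀ x ∈ bulk a t c, CkAt (p + m + 1) ψ x ∧ (∀ k, CkAt (p + m + 1) (ψk k) x) ∧
        TransportAt ψ ψk x) →
      ∑ k, ∫⁻ x in bulk a t c, density m (dρ^[p] (ψk k)) x ∂dv +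
          ∫⁻ x in bulk a t c, density m (dρ^[p] ψ) x ∂dv ≤
        ENNReal.ofReal K *
          (∑ k, ∫⁻ x, density m (dρ^[p] (ψk k)) x ∂initialSlice a (c / (1 + a)) +
            ∫⁻ x, density m (dρ^[p] ψ) x ∂initialSlice a (c / (1 + a))) := by
  obtain ⟨K, hK, hpair⟩ := exists_lintegral_density_pair_le hpm ha
  refine ⟨K * 4, by positivity, fun {t c} hat ht hc {ψ ψk} h => ?_⟩
  have hψ x (hx : x ∈ bulk a t c) := (h x hx).1
  have hψk k x (hx : x ∈ bulk a t c) := (h x hx).2.1 k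
  have hcomb (s : ℂ) x (hx : x ∈ bulk a t c) := (hψk 1 x hx).add ((hψ x hx).const_mul s)
  have hC1 {f : Field} {x : Pt} (hf : CkAt (p + m + 1) f x) : CkAt 1 f x := hf.mono (by omega)
  have hfst := hpair le_rfl le_rfl hat ht hc (hψk 2) (hcomb (1 / 2)) fun x hx =>
    (h x hx).2.2.transportPairAt_two_add (hC1 (hψk 1 x hx)) (hC1 (hψ x hx))
  have hsnd := hpair (by norm_num) zero_le_one hat ht hc (hcomb (-(1 / 2))) (hψk 0) fun x hx =>
    (h x hx).2.2.transportPairAt_sub_zero (hC1 (hψk 1 x hx)) (hC1 (hψ x hx))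
  have hsplit (ν : Measure Pt) (hν : ∀ᵐ x ∂ν, x ∈ bulk a t c) :=
    two_mul_lintegral_density_add_density_sub (ν := ν)
      (hν.mono fun x hx => (hψk 1 x hx).mono (Nat.le_succ _))
      (hν.mono fun x hx => (hψ x hx).mono (Nat.le_succ _))
  have hbulk := hsplit (dv.restrict (bulk a t c)) (ae_restrict_mem (measurableSet_bulk a t c))
  have hslice := hsplit _ (ae_initialSlice_mem_bulk ha hat)
  rw [Fin.sum_univ_three, Fin.sum_univ_three, ENNReal.ofReal_mul hK.le, ENNReal.ofReal_ofNat]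
  exact sum_le_of_paired_le hfst hsnd hbulk hslice

theorem bulk_subset_domain (ha : -1 < a) :
    bulk a t (2 * ε / (2 - ε) * ρs) ⊆ domain ε ρs a t := by
  rintro x ⟨hτ, hρ, hout⟩
  refine ⟨hτ.1, hτ.2.le, hρ.le, ?_⟩
  rw [ρmax, ← mul_div_assoc, le_div_iff₀ (by linarith [hτ.1])]
  exact hout.le

theorem ae_ne_ρmax (ε ρs : ℝ) : ∀ᵐ x : Pt ∂dv, x.2.1 ≠ ρmax ε ρs x.1 := by
  have hmeas : MeasurableSet {x : Pt | x.2.1 ≠ ρmax ε ρs x.1} :=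
    (measurableSet_eq_fun measurable_snd.fst (by unfold ρmax; fun_prop)).compl
  rw [dv, Measure.ae_prod_iff_ae_ae hmeas]
  exact .of_forall fun τ =>
    Measure.quasiMeasurePreserving_fst.ae (Measure.ae_ne volume (ρmax ε ρs τ))

theorem domain_ae_eq_bulk (ha : -1 < a) :
    domain ε ρs a t =ᵐ[dv] bulk a t (2 * ε / (2 - ε) * ρs) := by
  refine (Filter.EventuallyLE.antisymm ?_ (bulk_subset_domain ha).eventuallyLE)
  have ht : ∀ᵐ x : Pt ∂dv, x.1 ≠ t :=
    Measure.quasiMeasurePreserving_fst.ae (Measure.ae_ne volume t)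
  have h0 : ∀ᵐ x : Pt ∂dv, x.2.1 ≠ 0 := Measure.quasiMeasurePreserving_snd.ae
    (Measure.quasiMeasurePreserving_fst.ae (Measure.ae_ne volume 0))
  filter_upwards [ht, h0, ae_ne_ρmax ε ρs] with x hxt hx0 hxρ hx
  obtain ⟨haτ, hτt, hρ, hout⟩ : x ∈ domain ε ρs a t := hx
  refine ⟨⟨haτ, lt_of_le_of_ne hτt hxt⟩, lt_of_le_of_ne hρ hx0.symm, ?_⟩
  rw [← lt_div_iff₀ (by linarith), mul_div_assoc]
  exact lt_of_le_of_ne hout hxρ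

theorem sobolevSq_domain (ha : -1 < a) (m : ℕ) (f : Field) : sobolevSq m (domain ε ρs a t) f =
    ∫⁻ x in bulk a t (2 * ε / (2 - ε) * ρs), density m f x ∂dv :=
  setLIntegral_congr (domain_ae_eq_bulk ha)

theorem sliceSq_eq_lintegral_initialSlice (ε ρs a : ℝ) (m : ℕ) (f : Field) : sliceSq ε ρs m a f =
    ∫⁻ x, density m f x ∂initialSlice a (2 * ε / (2 - ε) * ρs / (1 + a)) := by
  rw [lintegral_initialSlice, slice_eq_restrict, mul_div_assoc, sliceSq, ρmax]

end Estimate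

end FGauge

end

theorem proposition1 (τs : ℝ) (hτs : -1 < τs) (hτs' : τs < 1) (p m : ℕ) (hpm : m + 1 < p) :
    ∃ C : ℝ, 0 < C ∧
      ∀ (ε ρs t : ℝ), 0 < ε → ε < 1 → 0 < ρs → τs < t → t ≤ 1 →
      ∀ (ψ : FGauge.Field) (ψk : Fin 3 → FGauge.Field),
        (∀ x ∈ FGauge.domain ε ρs τs t, x.1 < 1 → 0 < x.2.1 →
          FGauge.CkAt (p + m + 1) ψ x ∧ (∀ k, FGauge.CkAt (p + m + 1) (ψk k) x) ∧
            FGauge.TransportAt ψ ψk x) →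
        (∑ k, FGauge.sliceSq ε ρs m τs (FGauge.dρ^[p] (ψk k)))
            + FGauge.sliceSq ε ρs m τs (FGauge.dρ^[p] ψ) < ⊤ →
        (∑ k, FGauge.sobolevSq m (FGauge.domain ε ρs τs t) (FGauge.dρ^[p] (ψk k)))
            + FGauge.sobolevSq m (FGauge.domain ε ρs τs t) (FGauge.dρ^[p] ψ)
          ≤ ENNReal.ofReal C *
            ((∑ k, FGauge.sliceSq ε ρs m τs (FGauge.dρ^[p] (ψk k)))
              + FGauge.sliceSq ε ρs m τs (FGauge.dρ^[p] ψ)) := by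
  obtain ⟨K, hK, hbound⟩ := FGauge.exists_lintegral_density_hierarchy_le hpm hτs
  refine ⟨K, hK, fun ε ρs t hε hε' hρs hτt ht ψ ψk h _ => ?_⟩
  have hc : 0 < 2 * ε / (2 - ε) * ρs := mul_pos (div_pos (by linarith) (by linarith)) hρs
  simp only [FGauge.sobolevSq_domain hτs, FGauge.sliceSq_eq_lintegral_initialSlice]
  exact hbound hτt ht hc fun x hx =>
    h x (FGauge.bulk_subset_domain hτs hx) (hx.1.2.trans_le ht) hx.2.1
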